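/- Let $\Delta$ be a (nondegenerate) triangle in $\mathbb{R}^2$. An isosceles triangle (a nondegenerate triangle with at least two sides of equal length) is said to be embedded in $\Delta$ if it is contained in $\Delta$, where triangles are regarded as closed planar regions. (ii) Let $\Delta' \subseteq \Delta$ be a maximum-area embedded isosceles triangle in $\Delta$, i.e. no isosceles triangle contained in $\Delta$ has larger area than $\Delta'$. Then $\Delta'$ and $\Delta$ have a side in common, and at one endpoint of this side they also have the same angle. (iii) Let $\Delta' \subseteq \Delta$ be a maximum-perimeter embedded isosceles triangle in $\Delta$, i.e. no isosceles triangle contained in $\Delta$ has larger perimeter than $\Delta'$. Then $\Delta'$ and $\Delta$ have a side in common, and at one endpoint of this side they also have the same angle. -/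

import Mathlib

open MeasureTheory EuclideanGeometry

/-- The Euclidean plane `ℝ²`. -/
abbrev Plane : Type := EuclideanSpace ℝ (Fin 2)

/-- A (nondegenerate) triangle in the plane: three affinely independent vertices
`T.points 0`, `T.points 1`, `T.points 2`. -/
abbrev PlaneTriangle : Type := Affine.Triangle ℝ Plane

namespace PlaneTriangle

/-- The closed triangular region bounded by `T`, i.e. the convex hull of the vertices. -/
def region (T : PlaneTriangle) : Set Plane := T.closedInterior

/-- The area of a triangle: the Lebesgue measure of the closed triangular region. -/
noncomputable def area (T : PlaneTriangle) : ℝ := volume.real T.region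

/-- The perimeter of a triangle: the sum of its three side lengths. -/
noncomputable def perimeter (T : PlaneTriangle) : ℝ :=
  dist (T.points 0) (T.points 1) + dist (T.points 1) (T.points 2)
    + dist (T.points 2) (T.points 0)

/-- A triangle is isosceles if (at least) two of its sides have the same length. -/
def Isosceles (T : PlaneTriangle) : Prop :=
  ∃ i j k : Fin 3, i ≠ j ∧ i ≠ k ∧ j ≠ k ∧
    dist (T.points i) (T.points j) = dist (T.points i) (T.points k)

/-- `T` is an isosceles triangle embedded (contained) in `D`. -/
def IsEmbeddedIsosceles (D T : PlaneTriangle) : Prop :=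
  T.Isosceles ∧ T.region ⊆ D.region

/-- `T` is a maximum area embedded isosceles triangle in `D`. -/
def IsMaxAreaEmbeddedIsosceles (D T : PlaneTriangle) : Prop :=
  D.IsEmbeddedIsosceles T ∧ ∀ S : PlaneTriangle, D.IsEmbeddedIsosceles S → S.area ≤ T.area

/-- `T` is a maximum perimeter embedded isosceles triangle in `D`. -/
def IsMaxPerimeterEmbeddedIsosceles (D T : PlaneTriangle) : Prop :=
  D.IsEmbeddedIsosceles T ∧
    ∀ S : PlaneTriangle, D.IsEmbeddedIsosceles S → S.perimeter ≤ T.perimeter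

/-- `T` and `D` have a side in common, and at one endpoint of this side they have the same angle.
The common side joins the vertices `i`, `j` of `T`, which are the vertices `i'`, `j'` of `D`, and
the angles of `T` and `D` at its endpoint `T.points i = D.points i'` are equal. -/
def ShareSideAndAngle (T D : PlaneTriangle) : Prop :=
  ∃ i j k i' j' k' : Fin 3,
    (i ≠ j ∧ i ≠ k ∧ j ≠ k) ∧ (i' ≠ j' ∧ i' ≠ k' ∧ j' ≠ k') ∧
    T.points i = D.points i' ∧ T.points j = D.points j' ∧
    ∠ (T.points j) (T.points i) (T.points k) = ∠ (D.points j') (D.points i') (D.points k')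

end PlaneTriangle

/-! A maximizer `T` admits no strictly larger similar copy inside `D` (`NoLargerCopy`), and this
alone forces many incidences between vertices of `T` and sides of `D`. Direct similarities have four
infinitesimal parameters, and each incidence of a vertex with a side is one linear condition on
them. A motion that satisfies every active condition can be run both forwards and backwards, so it
must have trivial rotation and scaling part (`NoLargerCopy.direction_eq_zero`). Hence every side of
`D` is touched and there are at least four incidences (`NoLargerCopy.exists_bary_eq_zero`,
`NoLargerCopy.four_le_card`).

Four incidences on three vertices put a vertex of `T` at a vertex of `D`, and a finite analysis
(`incidence_cases`, `NoLargerCopy.cases`) leaves four configurations. In one of them the claimed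
side and angle are shared. In the others the third vertex over a common side is interior, or two
vertices lie on the open side opposite the shared vertex, or one vertex lies on an open side
adjacent to it and one on the open opposite side.

For each choice of apex, those three configurations are refuted in orthonormal coordinates, for area
and perimeter separately. Usually a one-parameter family of isosceles triangles through `T` is
monotone, is convex in the parameter, or has no critical point where needed; in the remaining cases
an explicit competitor elsewhere in `D` is larger. `ExcludesUnshared` collects these refutations,
and `shareSideAndAngle_of_excludesUnshared` combines them with the incidence analysis. -/

/-! ### Signed area, nondegeneracy and Lebesgue area -/

/-- Twice the signed area of the triangle `P Q R`. -/
noncomputable def cross (P Q R : Plane) : ℝ :=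
  (Q 0 - P 0) * (R 1 - P 1) - (Q 1 - P 1) * (R 0 - P 0)

lemma Plane.ext_coords {P Q : Plane} (h0 : P 0 = Q 0) (h1 : P 1 = Q 1) : P = Q := by
  ext i; fin_cases i <;> assumption

lemma Plane.dist_eq (P Q : Plane) :
    dist P Q = √((P 0 - Q 0) ^ 2 + (P 1 - Q 1) ^ 2) := by
  rw [EuclideanSpace.dist_eq]
  simp [Fin.sum_univ_two, Real.dist_eq, sq_abs]

/-- Cramer's rule: eliminating the other unknowns from a vanishing affine combination leaves each
weight times the signed area. -/
lemma affineIndependent_of_cross_ne_zero {P Q R : Plane} (h : cross P Q R ≠ 0) :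
    AffineIndependent ℝ ![P, Q, R] := by
  rw [affineIndependent_iff]
  intro s w hw hs
  have key : ∀ v : Fin 3 → ℝ, ∑ i, v i = 0 → ∑ i, v i • (![P, Q, R] i) = 0 → ∀ i, v i = 0 := by
    intro v hv hs
    have h0 := congrArg (fun X : Plane => X 0) hs
    have h1 := congrArg (fun X : Plane => X 1) hs
    simp [Fin.sum_univ_three] at h0 h1 hv
    have e1 : v 1 * cross P Q R = 0 := by
      unfold cross
      linear_combination (R 1 - P 1) * h0 - (R 0 - P 0) * h1
        + (P 1 * (R 0 - P 0) - P 0 * (R 1 - P 1)) * hv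
    have e2 : v 2 * cross P Q R = 0 := by
      unfold cross
      linear_combination (Q 0 - P 0) * h1 - (Q 1 - P 1) * h0
        - (P 1 * (Q 0 - P 0) - P 0 * (Q 1 - P 1)) * hv
    have e1 := (mul_eq_zero.1 e1).resolve_right h
    have e2 := (mul_eq_zero.1 e2).resolve_right h
    intro i
    fin_cases i
    · simp; linarith
    · exact e1
    · exact e2
  classical
  have h3 := key (fun i => if i ∈ s then w i else 0) (by simpa [Finset.sum_ite_mem] using hw)
    (by simpa [ite_smul, Finset.sum_ite_mem] using hs)
  intro i hi
  simpa [hi] using h3 i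

lemma cross_ne_zero_of_affineIndependent {P Q R : Plane} (h : AffineIndependent ℝ ![P, Q, R]) :
    cross P Q R ≠ 0 := by
  intro h0
  rw [affineIndependent_iff] at h
  unfold cross at h0
  have hQP : Q = P := by
    have key : ∀ r : Plane → ℝ, (r = (fun X => X 0) ∨ r = (fun X => X 1)) → r R - r P = 0 := by
      intro r hr
      -- For a coordinate function `r`, these weights sum to zero and annihilate `r` identically; on
      -- the other coordinate they give plus or minus the vanishing signed area.
      have := h Finset.univ ![r Q - r R, r R - r P, r P - r Q]
        (by simp [Fin.sum_univ_three])
        (by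
          apply Plane.ext_coords <;> rcases hr with rfl | rfl <;> simp [Fin.sum_univ_three]
          · ring
          · linear_combination h0
          · linear_combination -h0
          · ring) 1 (Finset.mem_univ _)
      simpa using this
    have k0 := key _ (Or.inl rfl)
    have k1 := key _ (Or.inr rfl)
    have hRP : R = P := Plane.ext_coords (by simpa [sub_eq_zero] using k0)
      (by simpa [sub_eq_zero] using k1)
    have := h Finset.univ ![-1, 0, 1] (by simp [Fin.sum_univ_three])
      (by simp [Fin.sum_univ_three, hRP]) 2 (Finset.mem_univ _)
    simp at this
  have := h Finset.univ ![-1, 1, 0] (by simp [Fin.sum_univ_three])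
      (by simp [Fin.sum_univ_three, hQP]) 1 (Finset.mem_univ _)
  simp at this

namespace PlaneTriangle

lemma cross_points_ne_zero (D : PlaneTriangle) :
    cross (D.points 0) (D.points 1) (D.points 2) ≠ 0 := by
  apply cross_ne_zero_of_affineIndependent
  convert D.independent using 1
  ext i; fin_cases i <;> rfl

/-- The triangle with given vertices. -/
noncomputable def ofPoints (P Q R : Plane) (h : cross P Q R ≠ 0) : PlaneTriangle :=
  ⟨![P, Q, R], affineIndependent_of_cross_ne_zero h⟩

lemma region_eq_convexHull (D : PlaneTriangle) :
    D.region = convexHull ℝ (Set.range D.points) :=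
  D.convexHull_eq_closedInterior.symm

lemma range_points (D : PlaneTriangle) :
    Set.range D.points = {D.points 0, D.points 1, D.points 2} := by
  ext x; simp [Fin.exists_fin_succ, eq_comm]

/-- Each triangle is an affine image of one reference triangle, and the determinant of the linear
part is the signed-area expression. The constant is the reference area; only its positivity matters
for comparing areas. -/
lemma exists_area_eq_mul_abs_cross :
    ∃ κ : ℝ, 0 < κ ∧ ∀ T : PlaneTriangle,
      T.area = κ * |cross (T.points 0) (T.points 1) (T.points 2)| := by
  let P : Plane := !₂[0, 0]
  let Q : Plane := !₂[1, 0]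
  let R : Plane := !₂[0, 1]
  have hPQR : cross P Q R ≠ 0 := by simp [cross, P, Q, R]
  let E := ofPoints P Q R hPQR
  refine ⟨E.area, ?_, ?_⟩
  · have hint : (interior E.region).Nonempty := by
      rw [region_eq_convexHull, interior_convexHull_nonempty_iff_affineSpan_eq_top]
      exact E.independent.affineSpan_eq_top_iff_card_eq_finrank_add_one.2 (by simp)
    have hc : IsCompact E.region := Affine.Simplex.isCompact_closedInterior _
    refine ENNReal.toReal_pos ?_ hc.measure_lt_top.ne
    exact (Measure.measure_pos_of_nonempty_interior _ hint).ne'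
  · intro T
    let B := (EuclideanSpace.basisFun (Fin 2) ℝ).toBasis
    let L : Plane →ₗ[ℝ] Plane := Matrix.toLin B B
      !![T.points 1 0 - T.points 0 0, T.points 2 0 - T.points 0 0;
        T.points 1 1 - T.points 0 1, T.points 2 1 - T.points 0 1]
    have hL : LinearMap.det L = cross (T.points 0) (T.points 1) (T.points 2) := by
      rw [LinearMap.det_toLin, Matrix.det_fin_two]
      simp [cross]; ring
    have hP : L P = 0 := by
      have : P = 0 := by apply Plane.ext_coords <;> simp [P]
      rw [this, map_zero]
    have hQ : L Q = T.points 1 - T.points 0 := by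
      have : Q = B 0 := by apply Plane.ext_coords <;> simp [Q, B]
      rw [this, Matrix.toLin_self]
      apply Plane.ext_coords <;> simp [B]
    have hR : L R = T.points 2 - T.points 0 := by
      have : R = B 1 := by apply Plane.ext_coords <;> simp [R, B]
      rw [this, Matrix.toLin_self]
      apply Plane.ext_coords <;> simp [B]
    have hreg : T.region = (fun x => T.points 0 + x) '' (L '' E.region) := by
      have : E.region = convexHull ℝ {P, Q, R} := by
        rw [region_eq_convexHull, range_points]; rfl
      rw [this, region_eq_convexHull, range_points, L.image_convexHull]
      have h2 := (AffineEquiv.constVAdd ℝ Plane (T.points 0)).toAffineMap.image_convexHull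
        (L '' {P, Q, R})
      rw [show (fun x => T.points 0 + x) =
        (AffineEquiv.constVAdd ℝ Plane (T.points 0)).toAffineMap from rfl, h2]
      simp [Set.image_insert_eq, hP, hQ, hR]
    rw [area, hreg, Measure.real, Set.image_add_left, measure_preimage_add,
      Measure.addHaar_image_linearMap, hL, ENNReal.toReal_mul,
      ENNReal.toReal_ofReal (abs_nonneg _), mul_comm]
    rfl

end PlaneTriangle

/-! ### Barycentric coordinates and membership in the region -/

namespace PlaneTriangle

/-- Barycentric coordinates with respect to a triangle. -/
noncomputable def bary (D : PlaneTriangle) (k : Fin 3) (P : Plane) : ℝ :=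
  cross (D.points (k + 1)) (D.points (k + 2)) P /
    cross (D.points 0) (D.points 1) (D.points 2)

lemma cross_points_ne_zero_of_ne (D : PlaneTriangle) {i j k : Fin 3} (hij : i ≠ j) (hik : i ≠ k)
    (hjk : j ≠ k) : cross (D.points i) (D.points j) (D.points k) ≠ 0 := by
  have h := D.cross_points_ne_zero
  contrapose! h
  unfold cross at h ⊢
  fin_cases i <;> fin_cases j <;> fin_cases k <;> simp at hij hik hjk h ⊢ <;>
    first
    | linear_combination h
    | linear_combination -h

lemma bary_eq (D : PlaneTriangle) {i j k : Fin 3} (hij : i ≠ j) (hik : i ≠ k)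
    (hjk : j ≠ k) (P : Plane) : D.bary k P =
      cross (D.points i) (D.points j) P / cross (D.points i) (D.points j) (D.points k) := by
  have h := D.cross_points_ne_zero_of_ne hij hik hjk
  unfold bary
  rw [div_eq_div_iff D.cross_points_ne_zero h]
  unfold cross
  fin_cases i <;> fin_cases j <;> fin_cases k <;> simp at hij hik hjk h ⊢ <;> ring_nf <;> simp

lemma sum_bary (D : PlaneTriangle) (P : Plane) : D.bary 0 P + D.bary 1 P + D.bary 2 P = 1 := by
  have h := D.cross_points_ne_zero
  unfold bary
  rw [← add_div, ← add_div, div_eq_one_iff_eq h]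
  simp [cross]; ring

lemma bary_smul_add (D : PlaneTriangle) (P : Plane) :
    P = D.bary 0 P • D.points 0 + D.bary 1 P • D.points 1 + D.bary 2 P • D.points 2 := by
  have h := D.cross_points_ne_zero
  apply Plane.ext_coords <;> simp [bary] <;> field_simp <;> simp [cross] <;> ring

lemma bary_combination (D : PlaneTriangle) {r s t : ℝ} (h : r + s + t = 1) (k : Fin 3) :
    D.bary k (r • D.points 0 + s • D.points 1 + t • D.points 2) = ![r, s, t] k := by
  have h0 := D.cross_points_ne_zero
  obtain rfl : r = 1 - s - t := by linarith
  unfold bary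
  rw [div_eq_iff h0]
  fin_cases k <;> simp [cross] <;> ring

lemma mem_region_iff (D : PlaneTriangle) (P : Plane) : P ∈ D.region ↔ ∀ k, 0 ≤ D.bary k P := by
  have hcomb : ∀ v : Fin 3 → ℝ, ∑ i, v i = 1 → Finset.univ.affineCombination ℝ D.points v =
      v 0 • D.points 0 + v 1 • D.points 1 + v 2 • D.points 2 := by
    intro v hv
    rw [Finset.univ.affineCombination_eq_linear_combination _ _ hv, Fin.sum_univ_three]
  constructor
  · rintro ⟨v, hv, hI, rfl⟩ k
    rw [hcomb v hv, bary_combination D (by rw [← hv, Fin.sum_univ_three])]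
    have := (hI k).1
    fin_cases k <;> exact this
  · intro h
    have hs := D.sum_bary P
    have hv : ∑ i, D.bary i P = 1 := by rw [Fin.sum_univ_three, hs]
    refine ⟨fun i => D.bary i P, hv, fun i => ⟨h i, ?_⟩, ?_⟩
    · rw [← hv]
      exact Finset.single_le_sum (f := fun i => D.bary i P) (fun i _ => h i) (Finset.mem_univ i)
    · rw [hcomb _ hv, ← bary_smul_add]

end PlaneTriangle

/-! ### Orthonormal coordinates adapted to a side -/

/-- Twice the signed area of a triangle given by coordinates. -/
def det (x₀ y₀ x₁ y₁ x₂ y₂ : ℝ) : ℝ := (x₁ - x₀) * (y₂ - y₀) - (y₁ - y₀) * (x₂ - x₀)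

/-- `φ` is a system of orthonormal coordinates with origin `A`, in which `C` lies on the positive
first axis and `B` in the upper half plane. -/
structure IsFrame (A C B : Plane) (b u w : ℝ) (φ : ℝ → ℝ → Plane) : Prop where
  hb : 0 < b
  hw : 0 < w
  map_A : φ 0 0 = A
  map_C : φ b 0 = C
  map_B : φ u w = B
  surj : ∀ P, ∃ x y, φ x y = P
  dist_eq : ∀ x y x' y', dist (φ x y) (φ x' y') = √((x - x') ^ 2 + (y - y') ^ 2)
  cross_eq : ∃ σ : ℝ, σ ^ 2 = 1 ∧ ∀ x₀ y₀ x₁ y₁ x₂ y₂,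
    cross (φ x₀ y₀) (φ x₁ y₁) (φ x₂ y₂) = σ * det x₀ y₀ x₁ y₁ x₂ y₂

lemma exists_isFrame {A C B : Plane} (h : cross A C B ≠ 0) :
    ∃ b u w φ, IsFrame A C B b u w φ := by
  have hpos : 0 < (C 0 - A 0) ^ 2 + (C 1 - A 1) ^ 2 := by
    by_contra! hle
    have h0 : C 0 - A 0 = 0 := by nlinarith [sq_nonneg (C 0 - A 0), sq_nonneg (C 1 - A 1)]
    have h1 : C 1 - A 1 = 0 := by nlinarith [sq_nonneg (C 0 - A 0), sq_nonneg (C 1 - A 1)]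
    exact h (by simp [cross, h0, h1])
  obtain ⟨b, hb, hb2⟩ : ∃ b, 0 < b ∧ b ^ 2 = (C 0 - A 0) ^ 2 + (C 1 - A 1) ^ 2 :=
    ⟨_, Real.sqrt_pos.2 hpos, Real.sq_sqrt hpos.le⟩
  obtain ⟨c, hc⟩ : ∃ c, C 0 - A 0 = b * c := ⟨(C 0 - A 0) / b, by field_simp⟩
  obtain ⟨s, hs⟩ : ∃ s, C 1 - A 1 = b * s := ⟨(C 1 - A 1) / b, by field_simp⟩
  have hcs : c ^ 2 + s ^ 2 = 1 := by
    rw [hc, hs] at hb2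
    have : b ^ 2 * (c ^ 2 + s ^ 2 - 1) = 0 := by linear_combination -hb2
    have := (mul_eq_zero.1 this).resolve_left (by positivity)
    linarith
  -- The sign `σ` is the orientation of the triangle; it reflects the second axis when needed so
  -- that the third vertex has positive height.
  obtain ⟨σ, hσ, hσ0⟩ : ∃ σ : ℝ, σ ^ 2 = 1 ∧ 0 < σ * cross A C B := by
    rcases lt_or_gt_of_ne h with h | h
    · exact ⟨-1, by norm_num, by linarith⟩
    · exact ⟨1, by norm_num, by linarith⟩
  let φ : ℝ → ℝ → Plane := fun x y => !₂[A 0 + c * x - σ * s * y, A 1 + s * x + σ * c * y]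
  refine ⟨b, c * (B 0 - A 0) + s * (B 1 - A 1), σ * (c * (B 1 - A 1) - s * (B 0 - A 0)), φ,
    ⟨hb, ?_, ?_, ?_, ?_, ?_, ?_, ?_⟩⟩
  · have : σ * cross A C B = b * (σ * (c * (B 1 - A 1) - s * (B 0 - A 0))) := by
      unfold cross; rw [hc, hs]; ring
    rw [this] at hσ0
    exact pos_of_mul_pos_right hσ0 hb.le
  · apply Plane.ext_coords <;> simp [φ]
  · apply Plane.ext_coords <;> simp [φ] <;> linarith
  · apply Plane.ext_coords <;> simp [φ]
    · linear_combination (B 0 - A 0) * hcs - s * (c * (B 1 - A 1) - s * (B 0 - A 0)) * hσ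
    · linear_combination (B 1 - A 1) * hcs + c * (c * (B 1 - A 1) - s * (B 0 - A 0)) * hσ
  · intro P
    refine ⟨c * (P 0 - A 0) + s * (P 1 - A 1), σ * (c * (P 1 - A 1) - s * (P 0 - A 0)), ?_⟩
    apply Plane.ext_coords <;> simp [φ]
    · linear_combination (P 0 - A 0) * hcs - s * (c * (P 1 - A 1) - s * (P 0 - A 0)) * hσ
    · linear_combination (P 1 - A 1) * hcs + c * (c * (P 1 - A 1) - s * (P 0 - A 0)) * hσ
  · intro x y x' y'
    rw [Plane.dist_eq]
    congr 1
    simp [φ]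
    linear_combination ((x - x') ^ 2 + (y - y') ^ 2) * hcs + (y - y') ^ 2 * (s ^ 2 + c ^ 2) * hσ
  · refine ⟨σ, hσ, ?_⟩
    intro x₀ y₀ x₁ y₁ x₂ y₂
    simp [cross, φ, det]
    linear_combination σ * ((x₁ - x₀) * (y₂ - y₀) - (y₁ - y₀) * (x₂ - x₀)) * hcs

/-- Membership of `(x, y)` in the closed triangle with vertices `(0, 0)`, `(b, 0)`, `(u, w)`. -/
structure InTri (b u w x y : ℝ) : Prop where
  h1 : 0 ≤ y
  h2 : 0 ≤ w * x - u * y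
  h3 : 0 ≤ w * (b - x) + (u - b) * y

namespace IsFrame

variable {D : PlaneTriangle} {i j k : Fin 3} {b u w : ℝ} {φ : ℝ → ℝ → Plane}

lemma bary_third (h : IsFrame (D.points i) (D.points j) (D.points k) b u w φ)
    (hij : i ≠ j) (hik : i ≠ k) (hjk : j ≠ k) (x y : ℝ) : D.bary k (φ x y) = y / w := by
  obtain ⟨σ, hσ, H⟩ := h.cross_eq
  have hσ0 : σ ≠ 0 := by rintro rfl; norm_num at hσ
  have := h.hb.ne'
  have := h.hw.ne'
  rw [D.bary_eq hij hik hjk, ← h.map_A, ← h.map_C, ← h.map_B, H, H]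
  simp only [det, sub_zero, sub_self, zero_mul]
  field_simp

lemma bary_second (h : IsFrame (D.points i) (D.points j) (D.points k) b u w φ)
    (hij : i ≠ j) (hik : i ≠ k) (hjk : j ≠ k) (x y : ℝ) :
    D.bary j (φ x y) = (w * x - u * y) / (w * b) := by
  obtain ⟨σ, hσ, H⟩ := h.cross_eq
  have hσ0 : σ ≠ 0 := by rintro rfl; norm_num at hσ
  have := h.hb.ne'
  have := h.hw.ne'
  rw [D.bary_eq hik hij hjk.symm, ← h.map_A, ← h.map_C, ← h.map_B, H, H]
  simp only [det, sub_zero, zero_sub, mul_zero]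
  field_simp
  ring

lemma bary_first (h : IsFrame (D.points i) (D.points j) (D.points k) b u w φ)
    (hij : i ≠ j) (hik : i ≠ k) (hjk : j ≠ k) (x y : ℝ) :
    D.bary i (φ x y) = (w * (b - x) + (u - b) * y) / (w * b) := by
  obtain ⟨σ, hσ, H⟩ := h.cross_eq
  have hσ0 : σ ≠ 0 := by rintro rfl; norm_num at hσ
  have := h.hb.ne'
  have := h.hw.ne'
  rw [D.bary_eq hjk hij.symm hik.symm, ← h.map_A, ← h.map_C, ← h.map_B, H, H]
  simp only [det, sub_zero, zero_sub, mul_zero]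
  field_simp
  ring

lemma mem_region_iff (h : IsFrame (D.points i) (D.points j) (D.points k) b u w φ)
    (hij : i ≠ j) (hik : i ≠ k) (hjk : j ≠ k) (x y : ℝ) :
    φ x y ∈ D.region ↔ InTri b u w x y := by
  have hb := h.hb
  have hw := h.hw
  have hwb : 0 < w * b := mul_pos hw hb
  have h1 := h.bary_first hij hik hjk x y
  have h2 := h.bary_second hij hik hjk x y
  have h3 := h.bary_third hij hik hjk x y
  rw [D.mem_region_iff]
  constructor
  · intro H
    refine ⟨?_, ?_, ?_⟩
    · have := H k
      rw [h3] at this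
      simpa [div_mul_cancel₀ _ hw.ne'] using mul_nonneg this hw.le
    · have := H j
      rw [h2] at this
      simpa only [div_mul_cancel₀ _ hwb.ne'] using mul_nonneg this hwb.le
    · have := H i
      rw [h1] at this
      simpa only [div_mul_cancel₀ _ hwb.ne'] using mul_nonneg this hwb.le
  · intro H l
    have hl : l = i ∨ l = j ∨ l = k := by omega
    rcases hl with rfl | rfl | rfl
    · rw [h1]; exact div_nonneg H.h3 hwb.le
    · rw [h2]; exact div_nonneg H.h2 hwb.le
    · rw [h3]; exact div_nonneg H.h1 hw.le

end IsFrame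

/-! ### First-order consequences of having no larger similar copy -/

namespace PlaneTriangle

lemma bary_points (D : PlaneTriangle) (i k : Fin 3) :
    D.bary k (D.points i) = if i = k then 1 else 0 := by
  have h := D.cross_points_ne_zero
  unfold bary
  rw [div_eq_iff h]
  fin_cases i <;> fin_cases k <;> simp [cross] <;> ring

lemma eq_of_bary_eq (D : PlaneTriangle) {P Q : Plane} (h : ∀ k, D.bary k P = D.bary k Q) :
    P = Q := by
  rw [D.bary_smul_add P, D.bary_smul_add Q, h, h, h]

lemma eq_points_of_bary_eq_zero (D : PlaneTriangle) {i j k : Fin 3} (hij : i ≠ j) (hik : i ≠ k)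
    (hjk : j ≠ k) {P : Plane} (hj : D.bary j P = 0) (hk : D.bary k P = 0) : P = D.points i := by
  have hs : D.bary i P = 1 := by
    rw [← D.sum_bary P]
    fin_cases i <;> fin_cases j <;> fin_cases k <;> simp at * <;> simp [*]
  apply D.eq_of_bary_eq
  intro l
  rw [bary_points]
  have hl : l = i ∨ l = j ∨ l = k := by omega
  rcases hl with rfl | rfl | rfl
  · simpa
  · simpa [hij]
  · simpa [hik]

lemma exists_bary_eq_affine (D : PlaneTriangle) (k : Fin 3) :
    ∃ α β γ : ℝ, ∀ P, D.bary k P = α * P 0 + β * P 1 + γ := by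
  refine ⟨(D.points (k + 1) 1 - D.points (k + 2) 1) /
      cross (D.points 0) (D.points 1) (D.points 2), (D.points (k + 2) 0 - D.points (k + 1) 0) /
      cross (D.points 0) (D.points 1) (D.points 2),
      cross (D.points (k + 1)) (D.points (k + 2)) 0 /
      cross (D.points 0) (D.points 1) (D.points 2), fun P => ?_⟩
  unfold bary
  field_simp [D.cross_points_ne_zero]
  simp [cross]; ring

lemma points_mem_region (D : PlaneTriangle) (j : Fin 3) : D.points j ∈ D.region :=
  D.point_mem_closedInterior j

lemma bary_nonneg {D T : PlaneTriangle} (h : T.region ⊆ D.region) (i j : Fin 3) :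
    0 ≤ D.bary i (T.points j) := (D.mem_region_iff _).1 (h (T.points_mem_region j)) i

/-- A barycentric coordinate is affine; if it vanished at three affinely independent points it would
vanish identically, yet it takes the value one at its own vertex. -/
lemma exists_bary_ne_zero (D T : PlaneTriangle) (i : Fin 3) : ∃ j, D.bary i (T.points j) ≠ 0 := by
  by_contra! h
  obtain ⟨α, β, γ, H⟩ := D.exists_bary_eq_affine i
  have h0 := h 0
  have h1 := h 1
  have h2 := h 2
  rw [H] at h0 h1 h2
  have hT := T.cross_points_ne_zero
  have hα : α * cross (T.points 0) (T.points 1) (T.points 2) = 0 := by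
    unfold cross
    linear_combination (T.points 2 1 - T.points 0 1) * (h1 - h0)
      - (T.points 1 1 - T.points 0 1) * (h2 - h0)
  have hβ : β * cross (T.points 0) (T.points 1) (T.points 2) = 0 := by
    unfold cross
    linear_combination -(T.points 2 0 - T.points 0 0) * (h1 - h0)
      + (T.points 1 0 - T.points 0 0) * (h2 - h0)
  obtain rfl := (mul_eq_zero.1 hα).resolve_right hT
  obtain rfl := (mul_eq_zero.1 hβ).resolve_right hT
  have e1 := D.bary_points i i
  have e2 := D.bary_points (i + 1) i
  rw [H] at e1 e2
  simp at e1 e2 h0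
  linarith

/-- No direct similarity of ratio larger than one maps `T` into `D`. -/
def NoLargerCopy (D T : PlaneTriangle) : Prop :=
  ∀ c s p q : ℝ, (∀ j, (!₂[p + c * T.points j 0 - s * T.points j 1,
    q + s * T.points j 0 + c * T.points j 1] : Plane) ∈ D.region) → c ^ 2 + s ^ 2 ≤ 1

/-- Perturb the identity by `ε` times the direction. Active constraints remain exactly zero because
they are affine in `ε`, and inactive ones remain positive for small `ε`, so both signs of `ε` are
admissible. -/
lemma NoLargerCopy.direction_eq_zero {D T : PlaneTriangle} (h : T.region ⊆ D.region)
    (hT : D.NoLargerCopy T) {c s p q : ℝ} {α β γ : Fin 3 → ℝ}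
    (H : ∀ i P, D.bary i P = α i * P 0 + β i * P 1 + γ i)
    (hz : ∀ i j, D.bary i (T.points j) = 0 →
      α i * (p + c * T.points j 0 - s * T.points j 1)
        + β i * (q + s * T.points j 0 + c * T.points j 1) = 0) :
    c = 0 ∧ s = 0 := by
  have hev : ∀ᶠ ε in nhds (0 : ℝ), ∀ j i, 0 ≤ D.bary i
      (!₂[ε * p + (1 + ε * c) * T.points j 0 - (ε * s) * T.points j 1,
        ε * q + (ε * s) * T.points j 0 + (1 + ε * c) * T.points j 1] : Plane) := by
    rw [Filter.eventually_all]
    intro j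
    rw [Filter.eventually_all]
    intro i
    have e : ∀ ε, D.bary i (!₂[ε * p + (1 + ε * c) * T.points j 0 - (ε * s) * T.points j 1,
        ε * q + (ε * s) * T.points j 0 + (1 + ε * c) * T.points j 1] : Plane) =
        D.bary i (T.points j) + ε * (α i * (p + c * T.points j 0 - s * T.points j 1)
        + β i * (q + s * T.points j 0 + c * T.points j 1)) := by
      intro ε
      rw [H, H]; simp; ring
    simp_rw [e]
    rcases (bary_nonneg h i j).eq_or_lt with h0 | h0
    · simp [← h0, hz i j h0.symm]
    · have : Filter.Tendsto (fun ε : ℝ => D.bary i (T.points j) + ε *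
          (α i * (p + c * T.points j 0 - s * T.points j 1)
        + β i * (q + s * T.points j 0 + c * T.points j 1))) (nhds 0)
          (nhds (D.bary i (T.points j) + 0 * (α i * (p + c * T.points j 0 - s * T.points j 1)
        + β i * (q + s * T.points j 0 + c * T.points j 1)))) :=
        Continuous.tendsto (by fun_prop) 0
      rw [zero_mul, add_zero] at this
      exact (this.eventually (lt_mem_nhds h0)).mono fun _ h => h.le
  obtain ⟨δ, hδ, hball⟩ := Metric.eventually_nhds_iff.1 hev
  have h1 := hT (1 + δ / 2 * c) (δ / 2 * s) (δ / 2 * p) (δ / 2 * q)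
    (fun j => (D.mem_region_iff _).2 (hball (by simp [abs_of_pos hδ]; linarith) j))
  have h2 := hT (1 + -(δ / 2) * c) (-(δ / 2) * s) (-(δ / 2) * p) (-(δ / 2) * q)
    (fun j => (D.mem_region_iff _).2 (hball (by simp [abs_of_pos hδ]; linarith) j))
  -- Adding the bounds for opposite perturbations cancels the terms linear in `δ`.
  have h3 : δ ^ 2 * (c ^ 2 + s ^ 2) ≤ 0 := by nlinarith
  have h4 : c ^ 2 + s ^ 2 ≤ 0 := by
    by_contra! h5
    have := mul_pos (pow_pos hδ 2) h5
    linarith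
  exact ⟨by nlinarith [sq_nonneg c, sq_nonneg s], by nlinarith [sq_nonneg c, sq_nonneg s]⟩

/-- If the side opposite vertex `i` were untouched, dilation about that vertex would preserve every
active constraint, since the other two sides pass through the centre. -/
lemma NoLargerCopy.exists_bary_eq_zero {D T : PlaneTriangle} (h : T.region ⊆ D.region)
    (hT : D.NoLargerCopy T) (i : Fin 3) : ∃ j, D.bary i (T.points j) = 0 := by
  by_contra! hi
  choose α β γ H using D.exists_bary_eq_affine
  have := hT.direction_eq_zero (c := 1) (s := 0) (p := -D.points i 0) (q := -D.points i 1) h H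
    (by
      intro k j hk
      have hki : i ≠ k := by rintro rfl; exact hi j hk
      have e := D.bary_points i k
      rw [if_neg hki] at e
      rw [H] at e hk
      linear_combination hk - e)
  exact one_ne_zero this.1

-- Three or fewer linear conditions on the four parameters of a similarity have a nonzero common
-- solution.
open Classical in
lemma NoLargerCopy.four_le_card {D T : PlaneTriangle} (h : T.region ⊆ D.region)
    (hT : D.NoLargerCopy T) :
    4 ≤ (Finset.univ.filter fun x : Fin 3 × Fin 3 => D.bary x.1 (T.points x.2) = 0).card := by
  by_contra! hlt
  choose α β γ H using D.exists_bary_eq_affine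
  set I := Finset.univ.filter fun x : Fin 3 × Fin 3 => D.bary x.1 (T.points x.2) = 0
  let M : Matrix I (Fin 4) ℝ := Matrix.of fun x =>
    ![α x.1.1 * T.points x.1.2 0 + β x.1.1 * T.points x.1.2 1,
      β x.1.1 * T.points x.1.2 0 - α x.1.1 * T.points x.1.2 1, α x.1.1, β x.1.1]
  have hker : LinearMap.ker M.mulVecLin ≠ ⊥ := by
    apply LinearMap.ker_ne_bot_of_finrank_lt
    simpa using hlt
  obtain ⟨v, hv, hv0⟩ := Submodule.exists_mem_ne_zero_of_ne_bot hker
  have hz : ∀ i j, D.bary i (T.points j) = 0 →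
      α i * (v 2 + v 0 * T.points j 0 - v 1 * T.points j 1)
        + β i * (v 3 + v 1 * T.points j 0 + v 0 * T.points j 1) = 0 := by
    intro i j hij
    have := congrFun (LinearMap.mem_ker.1 hv) ⟨(i, j), by simp [I, hij]⟩
    simp [Matrix.mulVec, dotProduct, Fin.sum_univ_four, M] at this
    linear_combination this
  obtain ⟨h0, h1⟩ := hT.direction_eq_zero h H hz
  -- The solution is now a pure translation. Every side is touched, so the translation is parallel
  -- to all three sides and must be zero.
  have hlin : ∀ i, α i * v 2 + β i * v 3 = 0 := by
    intro i
    obtain ⟨j, hj⟩ := hT.exists_bary_eq_zero h i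
    have := hz i j hj
    rw [h0, h1] at this
    linear_combination this
  have := D.eq_of_bary_eq (P := !₂[v 2, v 3]) (Q := 0) (by
    intro k
    rw [H, H]
    simpa using hlin k)
  have h2 := congrArg (fun X : Plane => X 0) this
  have h3 := congrArg (fun X : Plane => X 1) this
  simp at h2 h3
  apply hv0
  ext i
  fin_cases i <;> simp [*]

end PlaneTriangle

/-! ### Combinatorics of the incidences -/

lemma Fin.exists_ne_ne (a b : Fin 3) : ∃ c, a ≠ c ∧ b ≠ c := by
  decide +revert

/-- The possible patterns of incidences `Z i a` between vertices `a` and sides `i`. -/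
lemma incidence_cases {Z : Fin 3 → Fin 3 → Prop} [∀ i a, Decidable (Z i a)]
    (hvert : ∀ a, ∃ i, ¬ Z i a) (hside : ∀ i, ∃ a, ¬ Z i a) (htouch : ∀ i, ∃ a, Z i a)
    (hinj : ∀ i j a c, i ≠ j → a ≠ c → Z i a → Z j a → Z i c → ¬ Z j c)
    (hcard : 4 ≤ (Finset.univ.filter fun x : Fin 3 × Fin 3 => Z x.1 x.2).card) :
    ∃ a b c i j k : Fin 3, (a ≠ b ∧ a ≠ c ∧ b ≠ c) ∧ (i ≠ j ∧ i ≠ k ∧ j ≠ k) ∧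
      ((Z j a ∧ Z k a ∧ Z i b ∧ Z k b ∧ Z j c) ∨
      (Z j a ∧ Z k a ∧ Z i b ∧ Z k b ∧ ¬ Z i c ∧ ¬ Z j c ∧ ¬ Z k c) ∨
      (Z j a ∧ Z k a ∧ Z i b ∧ ¬ Z j b ∧ ¬ Z k b ∧ Z i c ∧ ¬ Z j c ∧ ¬ Z k c) ∨
      (Z j a ∧ Z k a ∧ Z k b ∧ ¬ Z i b ∧ ¬ Z j b ∧ Z i c ∧ ¬ Z j c ∧ ¬ Z k c)) := by
  -- Pigeonhole: four incidences on three vertices place one vertex on two sides.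
  have hcol : ∃ a i j k, (i ≠ j ∧ i ≠ k ∧ j ≠ k) ∧ Z j a ∧ Z k a ∧ ¬ Z i a := by
    obtain ⟨x, hx, y, hy, hxy, hxy2⟩ := Finset.exists_ne_map_eq_of_card_lt_of_maps_to
      (s := Finset.univ.filter fun x : Fin 3 × Fin 3 => Z x.1 x.2) (t := Finset.univ)
      (f := Prod.snd) (by simpa using lt_of_lt_of_le (by norm_num) hcard) (by simp)
    simp only [Finset.mem_filter, Finset.mem_univ, true_and] at hx hy
    have h12 : x.1 ≠ y.1 := fun h => hxy (Prod.ext h hxy2)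
    obtain ⟨i, hi⟩ := hvert x.2
    rw [← hxy2] at hy
    exact ⟨x.2, i, x.1, y.1, ⟨fun h => hi (h ▸ hx), fun h => hi (h ▸ hy), h12⟩, hx, hy, hi⟩
  obtain ⟨a, i, j, k, ⟨hij, hik, hjk⟩, hja, hka, hia⟩ := hcol
  obtain ⟨b, hib⟩ := htouch i
  have hab : a ≠ b := fun h => hia (h ▸ hib)
  obtain ⟨c, hac, hbc⟩ := Fin.exists_ne_ne a b
  have hbT : ¬ (Z j b ∧ Z k b) := fun h => hinj j k a b hjk hab hja hka h.1 h.2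
  have hcT : ¬ (Z j c ∧ Z k c) := fun h => hinj j k a c hjk hac hja hka h.1 h.2
  have hside' : ∀ l, Z l a → Z l b → ¬ Z l c := by
    intro l h1 h2 h3
    obtain ⟨d, hd⟩ := hside l
    have : d = a ∨ d = b ∨ d = c := by omega
    rcases this with rfl | rfl | rfl <;> contradiction
  -- Two incidences at `a` and one on side `i` make only three, so one of the remaining
  -- possibilities must supply a fourth.
  have hfour : Z j b ∨ Z k b ∨ Z i c ∨ Z j c ∨ Z k c := by
    by_contra! hno
    obtain ⟨hn1, hn2, hn3, hn4, hn5⟩ := hno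
    have hsub : (Finset.univ.filter fun x : Fin 3 × Fin 3 => Z x.1 x.2) ⊆
        {(j, a), (k, a), (i, b)} := by
      rintro ⟨l, d⟩ hx
      simp only [Finset.mem_filter, Finset.mem_univ, true_and] at hx
      have hl : l = i ∨ l = j ∨ l = k := by omega
      have hd : d = a ∨ d = b ∨ d = c := by omega
      rcases hl with rfl | rfl | rfl <;> rcases hd with rfl | rfl | rfl <;> first | contradiction | simp
    have := (Finset.card_le_card hsub).trans Finset.card_le_three
    omega
  have hj' := hside' j
  have hk' := hside' k
  by_cases hjb : Z j b
  · have hkb : ¬ Z k b := fun h => hbT ⟨hjb, h⟩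
    have hjc := hj' hja hjb
    by_cases hic : Z i c
    · exact ⟨b, a, c, k, i, j, ⟨hab.symm, hbc, hac⟩, ⟨hik.symm, hjk.symm, hij⟩,
        Or.inl ⟨hib, hjb, hka, hja, hic⟩⟩
    · by_cases hkc : Z k c
      · exact ⟨a, b, c, i, k, j, ⟨hab, hac, hbc⟩, ⟨hik, hij, hjk.symm⟩,
          Or.inl ⟨hka, hja, hib, hjb, hkc⟩⟩
      · exact ⟨a, b, c, i, k, j, ⟨hab, hac, hbc⟩, ⟨hik, hij, hjk.symm⟩,
          Or.inr (Or.inl ⟨hka, hja, hib, hjb, hic, hkc, hjc⟩)⟩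
  by_cases hkb : Z k b
  · have hkc := hk' hka hkb
    by_cases hic : Z i c
    · exact ⟨b, a, c, j, i, k, ⟨hab.symm, hbc, hac⟩, ⟨hij.symm, hjk, hik⟩,
        Or.inl ⟨hib, hkb, hja, hka, hic⟩⟩
    · by_cases hjc : Z j c
      · exact ⟨a, b, c, i, j, k, ⟨hab, hac, hbc⟩, ⟨hij, hik, hjk⟩,
          Or.inl ⟨hja, hka, hib, hkb, hjc⟩⟩
      · exact ⟨a, b, c, i, j, k, ⟨hab, hac, hbc⟩, ⟨hij, hik, hjk⟩,
          Or.inr (Or.inl ⟨hja, hka, hib, hkb, hic, hjc, hkc⟩)⟩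
  by_cases hic : Z i c
  · by_cases hjc : Z j c
    · exact ⟨c, a, b, k, i, j, ⟨hac.symm, hbc.symm, hab⟩, ⟨hik.symm, hjk.symm, hij⟩,
        Or.inl ⟨hic, hjc, hka, hja, hib⟩⟩
    by_cases hkc : Z k c
    · exact ⟨c, a, b, j, i, k, ⟨hac.symm, hbc.symm, hab⟩, ⟨hij.symm, hjk, hik⟩,
        Or.inl ⟨hic, hkc, hja, hka, hib⟩⟩
    · exact ⟨a, b, c, i, j, k, ⟨hab, hac, hbc⟩, ⟨hij, hik, hjk⟩,
        Or.inr (Or.inr (Or.inl ⟨hja, hka, hib, hjb, hkb, hic, hjc, hkc⟩))⟩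
  · by_cases hjc : Z j c
    · exact ⟨a, c, b, i, k, j, ⟨hac, hab, hbc.symm⟩, ⟨hik, hij, hjk.symm⟩,
        Or.inr (Or.inr (Or.inr ⟨hka, hja, hjc, hic, fun h => hcT ⟨hjc, h⟩, hib, hkb, hjb⟩))⟩
    · have hkc : Z k c := by
        rcases hfour with h | h | h | h | h <;> first | contradiction | exact h
      exact ⟨a, c, b, i, j, k, ⟨hac, hab, hbc.symm⟩, ⟨hij, hik, hjk⟩,
        Or.inr (Or.inr (Or.inr ⟨hja, hka, hkc, hic, hjc, hib, hjb, hkb⟩))⟩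

namespace PlaneTriangle

-- The first alternative gives the common side and angle; the other three are the configurations to
-- be refuted.
open Classical in
lemma NoLargerCopy.cases {D T : PlaneTriangle} (h : T.region ⊆ D.region)
    (hT : D.NoLargerCopy T) :
    ∃ a b c i j k : Fin 3, (a ≠ b ∧ a ≠ c ∧ b ≠ c) ∧ (i ≠ j ∧ i ≠ k ∧ j ≠ k) ∧
      ((T.points a = D.points i ∧ T.points b = D.points j ∧ D.bary j (T.points c) = 0) ∨
      (T.points a = D.points i ∧ T.points b = D.points j ∧ ∀ l, 0 < D.bary l (T.points c)) ∨
      (T.points a = D.points i ∧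
        (D.bary i (T.points b) = 0 ∧ 0 < D.bary j (T.points b) ∧ 0 < D.bary k (T.points b)) ∧
        D.bary i (T.points c) = 0 ∧ 0 < D.bary j (T.points c) ∧ 0 < D.bary k (T.points c)) ∨
      (T.points a = D.points i ∧
        (D.bary k (T.points b) = 0 ∧ 0 < D.bary i (T.points b) ∧ 0 < D.bary j (T.points b)) ∧
        D.bary i (T.points c) = 0 ∧ 0 < D.bary j (T.points c) ∧ 0 < D.bary k (T.points c))) := by
  have hpos : ∀ {i j}, ¬ D.bary i (T.points j) = 0 → 0 < D.bary i (T.points j) :=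
    fun {i j} h' => lt_of_le_of_ne (bary_nonneg h i j) (Ne.symm h')
  obtain ⟨a, b, c, i, j, k, habc, hijk, H⟩ := incidence_cases
    (Z := fun i a => D.bary i (T.points a) = 0)
    (by
      intro a
      by_contra! h0
      have := D.sum_bary (T.points a)
      rw [h0, h0, h0] at this
      norm_num at this)
    (D.exists_bary_ne_zero T) (hT.exists_bary_eq_zero h)
    (by
      intro i j a c hij hac hia hja hic hjc
      obtain ⟨k, hki, hkj⟩ := Fin.exists_ne_ne i j
      exact hac (T.independent.injective
        ((D.eq_points_of_bary_eq_zero hki.symm hkj.symm hij hia hja).trans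
        (D.eq_points_of_bary_eq_zero hki.symm hkj.symm hij hic hjc).symm)))
    (hT.four_le_card h)
  refine ⟨a, b, c, i, j, k, habc, hijk, ?_⟩
  obtain ⟨hij, hik, hjk⟩ := hijk
  have pi : ∀ {P}, D.bary j P = 0 → D.bary k P = 0 → P = D.points i :=
    fun {P} h1 h2 => D.eq_points_of_bary_eq_zero hij hik hjk h1 h2
  have pj : ∀ {P}, D.bary i P = 0 → D.bary k P = 0 → P = D.points j :=
    fun {P} h1 h2 => D.eq_points_of_bary_eq_zero hij.symm hjk hik h1 h2
  rcases H with ⟨h1, h2, h3, h4, h5⟩ | ⟨h1, h2, h3, h4, h5, h6, h7⟩ |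
    ⟨h1, h2, h3, h4, h5, h6, h7, h8⟩ | ⟨h1, h2, h3, h4, h5, h6, h7, h8⟩
  · exact Or.inl ⟨pi h1 h2, pj h3 h4, h5⟩
  · refine Or.inr (Or.inl ⟨pi h1 h2, pj h3 h4, fun l => ?_⟩)
    have hl : l = i ∨ l = j ∨ l = k := by omega
    rcases hl with rfl | rfl | rfl <;> exact hpos ‹_›
  · exact Or.inr (Or.inr (Or.inl ⟨pi h1 h2, ⟨h3, hpos h4, hpos h5⟩, h6, hpos h7, hpos h8⟩))
  · exact Or.inr (Or.inr (Or.inr ⟨pi h1 h2, ⟨h3, hpos h4, hpos h5⟩, h6, hpos h7, hpos h8⟩))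

end PlaneTriangle

/-! ### Perturbation and convexity tools -/

lemma Filter.Eventually.exists_gt_of_nhds {P : ℝ → Prop} {t : ℝ} (h : ∀ᶠ s in nhds t, P s) :
    ∃ s > t, P s := by
  obtain ⟨δ, hδ, hb⟩ := Metric.eventually_nhds_iff.1 h
  exact ⟨t + δ / 2, by linarith, hb (by simp [abs_of_pos hδ]; linarith)⟩

lemma Filter.Eventually.exists_symm_of_nhds {P : ℝ → Prop} {t : ℝ} (h : ∀ᶠ s in nhds t, P s) :
    ∃ ε > 0, P (t + ε) ∧ P (t - ε) := by
  obtain ⟨δ, hδ, hb⟩ := Metric.eventually_nhds_iff.1 h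
  exact ⟨δ / 2, by linarith, hb (by simp [abs_of_pos hδ]; linarith),
    hb (by simp [abs_of_pos hδ]; linarith)⟩

lemma exists_polar {x z ρ : ℝ} (hρ : 0 < ρ) (hz : 0 < z) (h : x ^ 2 + z ^ 2 = ρ ^ 2) :
    ∃ θ, 0 < θ ∧ θ < Real.pi ∧ x = ρ * Real.cos θ ∧ z = ρ * Real.sin θ := by
  have h1 : (x / ρ) ^ 2 + (z / ρ) ^ 2 = 1 := by field_simp; exact h
  have hzρ : 0 < z / ρ := div_pos hz hρ
  have hlt : (x / ρ) ^ 2 < 1 := by nlinarith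
  have habs := abs_lt.1 ((sq_lt_one_iff_abs_lt_one _).1 hlt)
  have hs : Real.sin (Real.arccos (x / ρ)) = z / ρ := by
    rw [Real.sin_arccos, show 1 - (x / ρ) ^ 2 = (z / ρ) ^ 2 by linarith, Real.sqrt_sq hzρ.le]
  refine ⟨Real.arccos (x / ρ), Real.arccos_pos.2 habs.2, ?_, ?_, ?_⟩
  · refine lt_of_le_of_ne (Real.arccos_le_pi _) fun h => ?_
    rw [h, Real.sin_pi] at hs
    linarith
  · rw [Real.cos_arccos habs.1.le habs.2.le]; field_simp
  · rw [hs]; field_simp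

/-- The planar triangle inequality, used below as midpoint convexity of a distance along a line. -/
lemma sqrt_add_sqrt_ge (a b c d : ℝ) :
    √((a + c) ^ 2 + (b + d) ^ 2) ≤ √(a ^ 2 + b ^ 2) + √(c ^ 2 + d ^ 2) := by
  rw [Real.sqrt_le_left (by positivity)]
  have h1 := Real.sq_sqrt (show 0 ≤ a ^ 2 + b ^ 2 by positivity)
  have h2 := Real.sq_sqrt (show 0 ≤ c ^ 2 + d ^ 2 by positivity)
  have h3 : a * c + b * d ≤ √(a ^ 2 + b ^ 2) * √(c ^ 2 + d ^ 2) := by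
    rw [← Real.sqrt_mul (by positivity)]
    apply Real.le_sqrt_of_sq_le
    nlinarith [sq_nonneg (a * d - b * c)]
  nlinarith

/-- The squared determinant is the defect in Cauchy–Schwarz, so non-parallel vectors give
strictness. -/
lemma sqrt_add_sqrt_gt {a b c d : ℝ} (h : a * d - b * c ≠ 0) :
    √((a + c) ^ 2 + (b + d) ^ 2) < √(a ^ 2 + b ^ 2) + √(c ^ 2 + d ^ 2) := by
  have hpos : 0 < (a * d - b * c) ^ 2 := by positivity
  have h1 := Real.sq_sqrt (show 0 ≤ a ^ 2 + b ^ 2 by positivity)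
  have h2 := Real.sq_sqrt (show 0 ≤ c ^ 2 + d ^ 2 by positivity)
  have h3 : a * c + b * d < √(a ^ 2 + b ^ 2) * √(c ^ 2 + d ^ 2) := by
    rw [← Real.sqrt_mul (by positivity)]
    apply Real.lt_sqrt_of_sq_lt
    nlinarith
  have h4 : 0 ≤ √(a ^ 2 + b ^ 2) + √(c ^ 2 + d ^ 2) := by positivity
  refine lt_of_le_of_ne (sqrt_add_sqrt_ge a b c d) fun h5 => ?_
  have h6 := Real.sq_sqrt (show 0 ≤ (a + c) ^ 2 + (b + d) ^ 2 by positivity)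
  rw [h5] at h6
  nlinarith

namespace InTri

variable {b u w x y : ℝ}

lemma axis (hw : 0 < w) (h0 : 0 ≤ x) (h1 : x ≤ b) : InTri b u w x 0 :=
  ⟨le_rfl, by nlinarith, by nlinarith⟩

lemma side (hb : 0 < b) (hw : 0 < w) {t : ℝ} (h0 : 0 ≤ t) (h1 : t ≤ 1) :
    InTri b u w (b + t * (u - b)) (t * w) :=
  ⟨by positivity, by nlinarith [mul_nonneg (mul_pos hw hb).le (sub_nonneg.2 h1)], by nlinarith⟩

lemma smul {s : ℝ} (h : InTri b u w x y) (hb : 0 < b) (hw : 0 < w) (h0 : 0 ≤ s) (h1 : s ≤ 1) :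
    InTri b u w (s * x) (s * y) :=
  ⟨mul_nonneg h0 h.h1, by nlinarith [mul_nonneg h0 h.h2],
    by nlinarith [mul_nonneg h0 h.h3, mul_nonneg (mul_pos hw hb).le (sub_nonneg.2 h1)]⟩

lemma apex (hw : 0 < w) : InTri b u w u w :=
  ⟨hw.le, by linarith, by linarith⟩

lemma eventually {X Y : ℝ → ℝ} {t : ℝ} (hX : ContinuousAt X t) (hY : ContinuousAt Y t)
    (h1 : 0 < Y t) (h2 : 0 < w * X t - u * Y t) (h3 : 0 < w * (b - X t) + (u - b) * Y t) :
    ∀ᶠ s in nhds t, InTri b u w (X s) (Y s) := by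
  have e1 := hY.eventually (lt_mem_nhds h1)
  have e2 := ((hX.const_mul w).sub (hY.const_mul u)).eventually (lt_mem_nhds h2)
  have e3 := (((hX.const_sub b).const_mul w).add (hY.const_mul (u - b))).eventually
    (lt_mem_nhds h3)
  filter_upwards [e1, e2, e3] with s g1 g2 g3
  exact ⟨g1.le, g2.le, g3.le⟩

end InTri

/-! ### Common side with the third vertex in the interior -/

/-- No isosceles triangle in the triangle `(0, 0)`, `(b, 0)`, `(u, w)` has larger area than the
triangle with the given coordinates. -/
def IsAreaMax (b u w x₀ y₀ x₁ y₁ x₂ y₂ : ℝ) : Prop :=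
  ∀ X₀ Y₀ X₁ Y₁ X₂ Y₂, InTri b u w X₀ Y₀ → InTri b u w X₁ Y₁ → InTri b u w X₂ Y₂ →
    (X₀ - X₁) ^ 2 + (Y₀ - Y₁) ^ 2 = (X₀ - X₂) ^ 2 + (Y₀ - Y₂) ^ 2 →
    det X₀ Y₀ X₁ Y₁ X₂ Y₂ ^ 2 ≤ det x₀ y₀ x₁ y₁ x₂ y₂ ^ 2

/-- No isosceles triangle in the triangle `(0, 0)`, `(b, 0)`, `(u, w)` has larger perimeter than
the isosceles triangle with the given coordinates (apex first). -/
def IsPerimeterMax (b u w x₀ y₀ x₁ y₁ x₂ y₂ : ℝ) : Prop :=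
  ∀ X₀ Y₀ X₁ Y₁ X₂ Y₂, InTri b u w X₀ Y₀ → InTri b u w X₁ Y₁ → InTri b u w X₂ Y₂ →
    (X₀ - X₁) ^ 2 + (Y₀ - Y₁) ^ 2 = (X₀ - X₂) ^ 2 + (Y₀ - Y₂) ^ 2 →
    det X₀ Y₀ X₁ Y₁ X₂ Y₂ ≠ 0 →
    2 * √((X₀ - X₁) ^ 2 + (Y₀ - Y₁) ^ 2) + √((X₁ - X₂) ^ 2 + (Y₁ - Y₂) ^ 2) ≤
      2 * √((x₀ - x₁) ^ 2 + (y₀ - y₁) ^ 2) + √((x₁ - x₂) ^ 2 + (y₁ - y₂) ^ 2)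

/-- There is room to raise the apex along the perpendicular bisector of the base. -/
lemma not_isAreaMax_interior_apex {b u w x z : ℝ} (hb : 0 < b) (hw : 0 < w) (hz : 0 < z)
    (h2 : 0 < w * x - u * z) (h3 : 0 < w * (b - x) + (u - b) * z)
    (hiso : (x - 0) ^ 2 + (z - 0) ^ 2 = (x - b) ^ 2 + (z - 0) ^ 2) :
    ¬ IsAreaMax b u w x z 0 0 b 0 := by
  intro H
  obtain ⟨z', hz', hin⟩ := (InTri.eventually (X := fun _ => x) (Y := fun s => s) (t := z)
    (by fun_prop) (by fun_prop) hz h2 h3).exists_gt_of_nhds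
  have := H x z' 0 0 b 0 hin (.axis hw le_rfl hb.le) (.axis hw hb.le le_rfl) (by linarith)
  simp only [det] at this
  have h4 : b * z < b * z' := by gcongr
  nlinarith [mul_pos hb hz]

lemma not_isPerimeterMax_interior_apex {b u w x z : ℝ} (hb : 0 < b) (hw : 0 < w) (hz : 0 < z)
    (h2 : 0 < w * x - u * z) (h3 : 0 < w * (b - x) + (u - b) * z)
    (hiso : (x - 0) ^ 2 + (z - 0) ^ 2 = (x - b) ^ 2 + (z - 0) ^ 2) :
    ¬ IsPerimeterMax b u w x z 0 0 b 0 := by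
  intro H
  obtain ⟨z', hz', hin⟩ := (InTri.eventually (X := fun _ => x) (Y := fun s => s) (t := z)
    (by fun_prop) (by fun_prop) hz h2 h3).exists_gt_of_nhds
  have := H x z' 0 0 b 0 hin (.axis hw le_rfl hb.le) (.axis hw hb.le le_rfl) (by linarith)
    (by simp only [det]; nlinarith [mul_pos hb (hz.trans hz')])
  have h4 : √((x - 0) ^ 2 + (z - 0) ^ 2) < √((x - 0) ^ 2 + (z' - 0) ^ 2) :=
    Real.sqrt_lt_sqrt (by positivity) (by nlinarith)
  linarith

/-- Opening the angle at the origin keeps both legs equal to `b` and lengthens the base. -/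
lemma not_isPerimeterMax_interior_base {b u w x z : ℝ} (hb : 0 < b) (hw : 0 < w) (hz : 0 < z)
    (h2 : 0 < w * x - u * z) (h3 : 0 < w * (b - x) + (u - b) * z)
    (hiso : (0 - b) ^ 2 + (0 - 0) ^ 2 = (0 - x) ^ 2 + (0 - z) ^ 2) :
    ¬ IsPerimeterMax b u w 0 0 b 0 x z := by
  intro H
  obtain ⟨θ, h0, hπ, rfl, rfl⟩ := exists_polar (x := x) hb hz (by linarith)
  have e1 := InTri.eventually (b := b) (u := u) (w := w) (X := fun s => b * Real.cos s)
    (Y := fun s => b * Real.sin s) (t := θ) (by fun_prop) (by fun_prop) hz h2 h3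
  obtain ⟨θ', hθ', hin, hπ'⟩ := (e1.and (gt_mem_nhds hπ)).exists_gt_of_nhds
  have hc := Real.cos_lt_cos_of_nonneg_of_le_pi h0.le hπ'.le hθ'
  have hs := Real.sin_pos_of_pos_of_lt_pi (h0.trans hθ') hπ'
  have e := Real.sin_sq_add_cos_sq θ
  have e' := Real.sin_sq_add_cos_sq θ'
  have := H 0 0 b 0 _ _ (.axis hw le_rfl hb.le) (.axis hw hb.le le_rfl) hin
    (by linear_combination (-b ^ 2) * e')
    (by simp only [det]; nlinarith [mul_pos hb (mul_pos hb hs)])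
  have h4 : √((b - b * Real.cos θ) ^ 2 + (0 - b * Real.sin θ) ^ 2) <
      √((b - b * Real.cos θ') ^ 2 + (0 - b * Real.sin θ') ^ 2) := by
    apply Real.sqrt_lt_sqrt (by positivity)
    have : b ^ 2 * Real.cos θ' < b ^ 2 * Real.cos θ := by gcongr
    nlinarith
  linarith

/-- Rotating the free leg makes a right angle the only possible critical position. That right
isosceles triangle is not excluded by rotation and is beaten by a different competitor. -/
lemma not_isAreaMax_interior_base {b u w x z : ℝ} (hb : 0 < b) (hw : 0 < w) (hz : 0 < z)
    (h2 : 0 < w * x - u * z) (h3 : 0 < w * (b - x) + (u - b) * z)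
    (hiso : (0 - b) ^ 2 + (0 - 0) ^ 2 = (0 - x) ^ 2 + (0 - z) ^ 2) :
    ¬ IsAreaMax b u w 0 0 b 0 x z := by
  intro H
  have hx : x = 0 := by
    obtain ⟨θ, h0, hπ, rfl, rfl⟩ := exists_polar (x := x) hb hz (by linarith)
    have e1 := InTri.eventually (b := b) (u := u) (w := w) (X := fun s => b * Real.cos s)
      (Y := fun s => b * Real.sin s) (t := θ) (by fun_prop) (by fun_prop) hz h2 h3
    have hmax : IsLocalMax (fun s => b ^ 4 * Real.sin s ^ 2) θ := by
      filter_upwards [e1] with θ' hin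
      have e' := Real.sin_sq_add_cos_sq θ'
      have := H 0 0 b 0 _ _ (.axis hw le_rfl hb.le) (.axis hw hb.le le_rfl) hin
        (by linear_combination (-b ^ 2) * e')
      simp only [det] at this
      linarith
    have hd := hmax.hasDerivAt_eq_zero (((Real.hasDerivAt_sin θ).pow 2).const_mul (b ^ 4))
    have hs : Real.sin θ ≠ 0 := (Real.sin_pos_of_pos_of_lt_pi h0 hπ).ne'
    simpa [hb.ne', hs] using hd
  subst hx
  have hzb : z = b := by nlinarith
  subst hzb
  have hu : u < 0 := by nlinarith
  have hwz : z - u < w := by nlinarith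
  have hd : 0 < u ^ 2 + w ^ 2 - u * z := by nlinarith
  have hn : 0 < u ^ 2 + w ^ 2 - z ^ 2 := by nlinarith
  -- The point `(s u, s w)` is where the perpendicular bisector of the side from `(b, 0)` to `(u,
  -- w)` meets the line from the origin to `(u, w)`; it becomes the new apex over that side.
  obtain ⟨s, hs⟩ : ∃ s, s * (2 * (u ^ 2 + w ^ 2 - u * z)) = u ^ 2 + w ^ 2 - z ^ 2 :=
    ⟨(u ^ 2 + w ^ 2 - z ^ 2) / (2 * (u ^ 2 + w ^ 2 - u * z)), by field_simp⟩
  have hs0 : 0 ≤ s := by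
    by_contra! h
    nlinarith
  have hs1 : (1 - s) * (2 * (u ^ 2 + w ^ 2 - u * z)) = (z - u) ^ 2 + w ^ 2 := by
    linear_combination -hs
  have hs2 : 0 < 1 - s := by
    by_contra! h
    nlinarith [sq_nonneg (z - u), sq_pos_of_pos hw]
  have := H (s * u) (s * w) z 0 u w ((InTri.apex hw).smul hb hw hs0 (by linarith))
    (.axis hw hb.le le_rfl) (.apex hw) (by linear_combination hs)
  simp only [det] at this
  -- The competitor has doubled area `z (1 - s) w`, to be compared with `z * z`. After writing `u =
  -- -p` and `w = z + p + r`, the polynomial difference has only positive coefficients.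
  have h4 : z < (1 - s) * w := by
    have : z * (2 * (u ^ 2 + w ^ 2 - u * z)) < ((z - u) ^ 2 + w ^ 2) * w := by
      obtain ⟨r, hr⟩ : ∃ r, w = z - u + r := ⟨w - (z - u), by ring⟩
      obtain ⟨p, hp⟩ : ∃ p, u = -p := ⟨-u, by ring⟩
      subst hp
      have : 0 < r := by linarith
      have : 0 < p := by linarith
      subst hr
      have : 0 < ((z - -p) ^ 2 + (z - -p + r) ^ 2) * (z - -p + r) -
        z * (2 * ((-p) ^ 2 + (z - -p + r) ^ 2 - -p * z)) := by
        ring_nf; positivity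
      linarith
    rw [← hs1] at this
    nlinarith
  have h5 : z * z < z * ((1 - s) * w) := by gcongr
  have h6 : (z * z) ^ 2 < (z * ((1 - s) * w)) ^ 2 := by gcongr
  nlinarith

/-! Triangles with one vertex at the apex `(u, w)` and two on the open opposite side. -/

/-- The base is centred at the foot of the altitude, so it can be widened symmetrically with the
apex fixed. -/
lemma not_isAreaMax_apex_opposite {b u w q r : ℝ} (hw : 0 < w) (hq0 : 0 < q)
    (hqb : q < b) (hr0 : 0 < r) (hrb : r < b) (hqr : q ≠ r)
    (hiso : (u - q) ^ 2 + (w - 0) ^ 2 = (u - r) ^ 2 + (w - 0) ^ 2) :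
    ¬ IsAreaMax b u w u w q 0 r 0 := by
  intro H
  have hu : q + r = 2 * u := by
    have : (q - r) * (q + r - 2 * u) = 0 := by linear_combination hiso
    have := (mul_eq_zero.1 this).resolve_left (sub_ne_zero.2 hqr)
    linarith
  have e1 : ∀ᶠ s in nhds (0 : ℝ), 0 < q + s * (q - r) ∧ q + s * (q - r) < b ∧
      0 < r - s * (q - r) ∧ r - s * (q - r) < b := by
    have c1 : Continuous fun s : ℝ => q + s * (q - r) := by fun_prop
    have c2 : Continuous fun s : ℝ => r - s * (q - r) := by fun_prop
    refine (c1.continuousAt.eventually (lt_mem_nhds (by simpa))).and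
      ((c1.continuousAt.eventually (gt_mem_nhds (by simpa))).and
      ((c2.continuousAt.eventually (lt_mem_nhds (by simpa))).and
      (c2.continuousAt.eventually (gt_mem_nhds (by simpa)))))
  obtain ⟨s, hs, g1, g2, g3, g4⟩ := e1.exists_gt_of_nhds
  have hb : 0 < b := hq0.trans hqb
  have := H u w _ 0 _ 0 (.apex hw) (.axis hw g1.le g2.le) (.axis hw g3.le g4.le)
    (by linear_combination (1 + 2 * s) * (q - r) * hu)
  simp only [det] at this
  have h1 : 0 < w ^ 2 * (q - r) ^ 2 := by
    have := sub_ne_zero.2 hqr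
    positivity
  nlinarith [mul_pos h1 hs, mul_pos h1 (mul_pos hs hs)]

lemma not_isPerimeterMax_apex_opposite {b u w q r : ℝ} (hw : 0 < w) (hq0 : 0 < q)
    (hqb : q < b) (hr0 : 0 < r) (hrb : r < b) (hqr : q ≠ r)
    (hiso : (u - q) ^ 2 + (w - 0) ^ 2 = (u - r) ^ 2 + (w - 0) ^ 2) :
    ¬ IsPerimeterMax b u w u w q 0 r 0 := by
  intro H
  have hu : q + r = 2 * u := by
    have : (q - r) * (q + r - 2 * u) = 0 := by linear_combination hiso
    have := (mul_eq_zero.1 this).resolve_left (sub_ne_zero.2 hqr)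
    linarith
  have e1 : ∀ᶠ s in nhds (0 : ℝ), 0 < q + s * (q - r) ∧ q + s * (q - r) < b ∧
      0 < r - s * (q - r) ∧ r - s * (q - r) < b := by
    have c1 : Continuous fun s : ℝ => q + s * (q - r) := by fun_prop
    have c2 : Continuous fun s : ℝ => r - s * (q - r) := by fun_prop
    refine (c1.continuousAt.eventually (lt_mem_nhds (by simpa))).and
      ((c1.continuousAt.eventually (gt_mem_nhds (by simpa))).and
      ((c2.continuousAt.eventually (lt_mem_nhds (by simpa))).and
      (c2.continuousAt.eventually (gt_mem_nhds (by simpa)))))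
  obtain ⟨s, hs, g1, g2, g3, g4⟩ := e1.exists_gt_of_nhds
  have hb : 0 < b := hq0.trans hqb
  have h1 : 0 < (q - r) ^ 2 := by
    have := sub_ne_zero.2 hqr
    positivity
  have := H u w _ 0 _ 0 (.apex hw) (.axis hw g1.le g2.le) (.axis hw g3.le g4.le)
    (by linear_combination (1 + 2 * s) * (q - r) * hu)
    (by
      have : det u w (q + s * (q - r)) 0 (r - s * (q - r)) 0 = w * ((1 + 2 * s) * (r - q)) := by
        simp only [det]; ring
      rw [this]
      have := sub_ne_zero.2 hqr.symm
      positivity)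
  have k1 : √((u - q) ^ 2 + (w - 0) ^ 2) < √((u - (q + s * (q - r))) ^ 2 + (w - 0) ^ 2) := by
    apply Real.sqrt_lt_sqrt (by positivity)
    obtain rfl : u = (q + r) / 2 := by linarith
    nlinarith [mul_pos h1 hs, mul_pos h1 (mul_pos hs hs)]
  have k2 : √((q - r) ^ 2 + (0 - 0) ^ 2) ≤
      √((q + s * (q - r) - (r - s * (q - r))) ^ 2 + (0 - 0) ^ 2) := by
    apply Real.sqrt_le_sqrt
    nlinarith [mul_pos h1 hs, mul_pos h1 (mul_pos hs hs)]
  linarith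

/-- The isosceles triangles with base from `(u, w)` to `(u + v y, 0)`, `v = ± 1`, and apex on the
first axis: if one of them lies in the open side, so do the nearby ones. -/
lemma eventually_base_on_axis {b u w v y : ℝ} (hy : y ≠ 0)
    (hq0 : 0 < u + v * ((y ^ 2 - w ^ 2) / (2 * y)))
    (hqb : u + v * ((y ^ 2 - w ^ 2) / (2 * y)) < b)
    (hr0 : 0 < u + v * y) (hrb : u + v * y < b) :
    ∀ᶠ s in nhds y, 0 < u + v * ((s ^ 2 - w ^ 2) / (2 * s)) ∧
      u + v * ((s ^ 2 - w ^ 2) / (2 * s)) < b ∧ 0 < u + v * s ∧ u + v * s < b := by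
  have c1 : ContinuousAt (fun s : ℝ => u + v * ((s ^ 2 - w ^ 2) / (2 * s))) y := by
    have : (2 * y) ≠ 0 := by positivity
    fun_prop (disch := assumption)
  have c2 : ContinuousAt (fun s : ℝ => u + v * s) y := by fun_prop
  exact (c1.eventually (lt_mem_nhds hq0)).and ((c1.eventually (gt_mem_nhds hqb)).and
    ((c2.eventually (lt_mem_nhds hr0)).and (c2.eventually (gt_mem_nhds hrb))))

/-- Here `v` records on which side of the foot `u` the point `r` lies and `y` is its distance from
that foot. The case `r = u` is impossible, as the leg to `(u, w)` would exceed the leg to its foot.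
-/
lemma exists_base_on_axis {u w q r : ℝ} (hw : 0 < w)
    (hiso : (q - u) ^ 2 + (0 - w) ^ 2 = (q - r) ^ 2 + (0 - 0) ^ 2) :
    ∃ v y : ℝ, v ^ 2 = 1 ∧ 0 < y ∧ q = u + v * ((y ^ 2 - w ^ 2) / (2 * y)) ∧ r = u + v * y := by
  have hru : r ≠ u := by rintro rfl; nlinarith
  have hq : ∀ v y : ℝ, v ^ 2 = 1 → 0 < y → r = u + v * y →
      q = u + v * ((y ^ 2 - w ^ 2) / (2 * y)) := by
    rintro v y hv hy rfl
    have : v * (2 * y * (q - u) - v * (y ^ 2 - w ^ 2)) = 0 := by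
      linear_combination hiso + w ^ 2 * hv
    have := (mul_eq_zero.1 this).resolve_left (by rintro rfl; norm_num at hv)
    field_simp
    linarith
  rcases lt_or_gt_of_ne hru with h | h
  · exact ⟨-1, u - r, by norm_num, by linarith, hq _ _ (by norm_num) (by linarith) (by ring),
      by ring⟩
  · exact ⟨1, r - u, by norm_num, by linarith, hq _ _ (by norm_num) (by linarith) (by ring),
      by ring⟩

/-- Strict midpoint convexity of the leg length `y / 2 + w ^ 2 / (2 y)`. -/
lemma two_mul_div_lt_add_div {w y ε : ℝ} (hw : 0 < w) (hε : 0 < ε) (h : ε < y) :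
    2 * (((y ^ 2 + w ^ 2) / (2 * y))) < ((y + ε) ^ 2 + w ^ 2) / (2 * (y + ε)) +
      ((y - ε) ^ 2 + w ^ 2) / (2 * (y - ε)) := by
  have h1 : 0 < y := hε.trans h
  have h2 : 0 < y - ε := sub_pos.2 h
  have e : ((y + ε) ^ 2 + w ^ 2) / (2 * (y + ε)) + ((y - ε) ^ 2 + w ^ 2) / (2 * (y - ε)) -
      2 * (((y ^ 2 + w ^ 2) / (2 * y))) = w ^ 2 * ε ^ 2 / (y * (y + ε) * (y - ε)) := by
    field_simp
    ring
  have : 0 < w ^ 2 * ε ^ 2 / (y * (y + ε) * (y - ε)) := by positivity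
  linarith

lemma leg_on_axis_sq {u w v y : ℝ} (hv : v ^ 2 = 1) (hy : y ≠ 0) :
    (u + v * ((y ^ 2 - w ^ 2) / (2 * y)) - u) ^ 2 + (0 - w) ^ 2 =
      ((y ^ 2 + w ^ 2) / (2 * y)) ^ 2 := by
  field_simp
  linear_combination (y ^ 2 - w ^ 2) ^ 2 * hv

lemma leg_on_axis_sq' {u w v y : ℝ} (hv : v ^ 2 = 1) (hy : y ≠ 0) :
    (u + v * ((y ^ 2 - w ^ 2) / (2 * y)) - (u + v * y)) ^ 2 + (0 - 0) ^ 2 =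
      ((y ^ 2 + w ^ 2) / (2 * y)) ^ 2 := by
  field_simp
  linear_combination (y ^ 2 + w ^ 2) ^ 2 * hv

lemma det_on_axis_sq {u w v y : ℝ} (hv : v ^ 2 = 1) (hy : y ≠ 0) :
    det (u + v * ((y ^ 2 - w ^ 2) / (2 * y))) 0 u w (u + v * y) 0 ^ 2 =
      w ^ 2 * ((y ^ 2 + w ^ 2) / (2 * y)) ^ 2 := by
  unfold det
  field_simp
  linear_combination w ^ 2 * (y ^ 2 + w ^ 2) ^ 2 * hv

/-- One leg lies on the axis and the opposite vertex has fixed height `w`, so area is proportional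
to the leg length. A strictly convex function has no interior maximum. -/
lemma not_isAreaMax_base_on_axis {b u w q r : ℝ} (hw : 0 < w) (hq0 : 0 < q)
    (hqb : q < b) (hr0 : 0 < r) (hrb : r < b)
    (hiso : (q - u) ^ 2 + (0 - w) ^ 2 = (q - r) ^ 2 + (0 - 0) ^ 2) :
    ¬ IsAreaMax b u w q 0 u w r 0 := by
  intro H
  have hb : 0 < b := hq0.trans hqb
  obtain ⟨v, y, hv, hy, rfl, rfl⟩ := exists_base_on_axis hw hiso
  obtain ⟨ε, hε, ⟨⟨a1, a2, a3, a4⟩, h1⟩, ⟨c1, c2, c3, c4⟩, h2⟩ :=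
    ((eventually_base_on_axis hy.ne' hq0 hqb hr0 hrb).and (lt_mem_nhds hy)).exists_symm_of_nhds
  have k1 := H _ 0 u w _ 0 (.axis hw a1.le a2.le) (.apex hw) (.axis hw a3.le a4.le)
    (by rw [leg_on_axis_sq hv h1.ne', leg_on_axis_sq' hv h1.ne'])
  have k2 := H _ 0 u w _ 0 (.axis hw c1.le c2.le) (.apex hw) (.axis hw c3.le c4.le)
    (by rw [leg_on_axis_sq hv h2.ne', leg_on_axis_sq' hv h2.ne'])
  rw [det_on_axis_sq hv hy.ne', det_on_axis_sq hv h1.ne',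
    mul_le_mul_iff_right₀ (by positivity), sq_le_sq₀ (by positivity) (by positivity)] at k1
  rw [det_on_axis_sq hv hy.ne', det_on_axis_sq hv h2.ne',
    mul_le_mul_iff_right₀ (by positivity), sq_le_sq₀ (by positivity) (by positivity)] at k2
  linarith [two_mul_div_lt_add_div (y := y) hw hε (by linarith)]

/-- The perimeter is twice the strictly convex leg length plus the convex base length `√(y ^ 2 + w ^
2)`. -/
lemma not_isPerimeterMax_base_on_axis {b u w q r : ℝ} (hw : 0 < w) (hq0 : 0 < q)
    (hqb : q < b) (hr0 : 0 < r) (hrb : r < b)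
    (hiso : (q - u) ^ 2 + (0 - w) ^ 2 = (q - r) ^ 2 + (0 - 0) ^ 2) :
    ¬ IsPerimeterMax b u w q 0 u w r 0 := by
  intro H
  have hb : 0 < b := hq0.trans hqb
  obtain ⟨v, y, hv, hy, rfl, rfl⟩ := exists_base_on_axis hw hiso
  obtain ⟨ε, hε, ⟨⟨a1, a2, a3, a4⟩, h1⟩, ⟨c1, c2, c3, c4⟩, h2⟩ :=
    ((eventually_base_on_axis hy.ne' hq0 hqb hr0 hrb).and (lt_mem_nhds hy)).exists_symm_of_nhds
  have hdet : ∀ s, 0 < s → det (u + v * ((s ^ 2 - w ^ 2) / (2 * s))) 0 u w (u + v * s) 0 ≠ 0 := by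
    intro s hs h0
    have := det_on_axis_sq (u := u) (w := w) hv hs.ne'
    rw [h0] at this
    have h3 : 0 < w ^ 2 * ((s ^ 2 + w ^ 2) / (2 * s)) ^ 2 := by positivity
    linarith
  have hbase : ∀ s, (u - (u + v * s)) ^ 2 + (w - 0) ^ 2 = s ^ 2 + w ^ 2 := by
    intro s; linear_combination s ^ 2 * hv
  have k1 := H _ 0 u w _ 0 (.axis hw a1.le a2.le) (.apex hw) (.axis hw a3.le a4.le)
    (by rw [leg_on_axis_sq hv h1.ne', leg_on_axis_sq' hv h1.ne']) (hdet _ h1)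
  have k2 := H _ 0 u w _ 0 (.axis hw c1.le c2.le) (.apex hw) (.axis hw c3.le c4.le)
    (by rw [leg_on_axis_sq hv h2.ne', leg_on_axis_sq' hv h2.ne']) (hdet _ h2)
  rw [leg_on_axis_sq hv hy.ne', leg_on_axis_sq hv h1.ne', Real.sqrt_sq (by positivity),
    Real.sqrt_sq (by positivity), hbase, hbase] at k1
  rw [leg_on_axis_sq hv hy.ne', leg_on_axis_sq hv h2.ne', Real.sqrt_sq (by positivity),
    Real.sqrt_sq (by positivity), hbase, hbase] at k2
  have k3 := sqrt_add_sqrt_ge (y + ε) w (y - ε) w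
  have k4 : √((y + ε + (y - ε)) ^ 2 + (w + w) ^ 2) = 2 * √(y ^ 2 + w ^ 2) := by
    rw [show (y + ε + (y - ε)) ^ 2 + (w + w) ^ 2 = 2 ^ 2 * (y ^ 2 + w ^ 2) by ring,
      Real.sqrt_mul (by positivity), Real.sqrt_sq (by norm_num)]
  linarith [two_mul_div_lt_add_div (y := y) hw hε (by linarith)]

/-! Triangles with vertices at the origin, at `(r, 0)`, and on the open side from `(b, 0)` to
`(u, w)`. -/

lemma eventually_side {t : ℝ} (ht0 : 0 < t) (ht1 : t < 1) : ∀ᶠ s in nhds t, 0 < s ∧ s < 1 :=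
  (lt_mem_nhds ht0).and (gt_mem_nhds ht1)

/-- The apex `(b / 2, h)` of the isosceles triangle over the base from `(0, 0)` to `(b, 0)` whose
base angle is the smaller of the base angles of the triangle with the same base and third vertex
`(b + t (u - b), t w)`. -/
lemma InTri.exists_midline {b u w t : ℝ} (hb : 0 < b) (hw : 0 < w) (ht0 : 0 < t) (ht1 : t < 1)
    (hx0 : 0 < b + t * (u - b)) (hxb : b + t * (u - b) < b) :
    ∃ h, 0 < h ∧ InTri b u w (b / 2) h ∧
      ((b + t * (u - b) ≤ b / 2 ∧ h * (2 * (b - (b + t * (u - b)))) = b * (t * w)) ∨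
      (b / 2 < b + t * (u - b) ∧ h * (2 * (b + t * (u - b))) = b * (t * w))) := by
  rcases le_or_gt (b + t * (u - b)) (b / 2) with h | h
  · have hd : 0 < b - u := by
      by_contra! h'
      nlinarith
    have hs : b / (2 * (b - u)) ≤ t := by
      rw [div_le_iff₀ (by positivity)]
      linarith
    have e : b / (2 * (b - u)) * (b - u) = b / 2 := by field_simp
    -- This is the height at which the line over `b / 2` meets the side from `(b, 0)` to `(u, w)`.
    refine ⟨b / (2 * (b - u)) * w, by positivity, ?_, Or.inl ⟨h, ?_⟩⟩
    · convert InTri.side (u := u) hb hw (t := b / (2 * (b - u))) (by positivity) (by linarith)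
        using 1
      linarith
    · linear_combination 2 * w * t * e
  · have e : b / (2 * (b + t * (u - b))) * (b + t * (u - b)) = b / 2 := by
      field_simp
    -- Here the line over `b / 2` instead meets the segment from the origin to the given side point.
    refine ⟨b / (2 * (b + t * (u - b))) * (t * w), by positivity, ?_, Or.inr ⟨h, ?_⟩⟩
    · have := (InTri.side (u := u) hb hw ht0.le ht1.le).smul
        (s := b / (2 * (b + t * (u - b)))) hb hw (by positivity)
        (by rw [div_le_one (by positivity)]; linarith)
      rwa [e] at this
    · linear_combination 2 * t * w * e

section

variable {b u w t r : ℝ}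

/-- The base is twice the abscissa of the apex, so the area is quadratic along the side. Its only
critical point with nonzero area would give `r = b`. -/
lemma not_isAreaMax_side_apex (hb : 0 < b) (hw : 0 < w) (ht0 : 0 < t)
    (ht1 : t < 1) (hr0 : 0 < r) (hrb : r < b)
    (hiso : (b + t * (u - b) - 0) ^ 2 + (t * w - 0) ^ 2 =
      (b + t * (u - b) - r) ^ 2 + (t * w - 0) ^ 2) :
    ¬ IsAreaMax b u w (b + t * (u - b)) (t * w) 0 0 r 0 := by
  intro H
  have hr : r = 2 * (b + t * (u - b)) := by
    have : r * (r - 2 * (b + t * (u - b))) = 0 := by linear_combination -hiso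
    have := (mul_eq_zero.1 this).resolve_left hr0.ne'
    linarith
  have c1 : Continuous fun s : ℝ => 2 * (b + s * (u - b)) := by fun_prop
  have hmax : IsLocalMax (fun s => (2 * (b + s * (u - b)) * (s * w)) ^ 2) t := by
    filter_upwards [eventually_side ht0 ht1, c1.continuousAt.eventually (lt_mem_nhds (hr ▸ hr0)),
      c1.continuousAt.eventually (gt_mem_nhds (hr ▸ hrb))] with s hs h1 h2
    have := H _ _ 0 0 _ 0 (.side hb hw hs.1.le hs.2.le) (.axis hw le_rfl hb.le)
      (.axis hw h1.le h2.le) (by ring)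
    simp only [det, hr] at this
    linarith
  have hd : HasDerivAt (fun s : ℝ => (2 * (b + s * (u - b)) * (s * w)) ^ 2)
      (2 * (2 * (b + t * (u - b)) * (t * w)) * (2 * w * (b + 2 * t * (u - b)))) t := by
    have h1 := ((((hasDerivAt_id t).mul_const (u - b)).const_add b).const_mul 2).mul
      ((hasDerivAt_id t).mul_const w)
    refine (h1.pow 2).congr_deriv ?_
    simp only [id_eq, Pi.mul_apply, Nat.cast_ofNat, Nat.add_one_sub_one, pow_one]
    ring
  have := hmax.hasDerivAt_eq_zero hd
  have h1 : 0 < b + t * (u - b) := by linarith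
  have h2 : 2 * w * (b + 2 * t * (u - b)) = 0 := (mul_eq_zero.1 this).resolve_left (by positivity)
  have h3 : b + 2 * t * (u - b) = 0 := (mul_eq_zero.1 h2).resolve_left (by positivity)
  linarith

/-- Along the side the perimeter is twice a distance to the origin plus an affine function. It is
strictly convex because the side does not pass through the origin. -/
lemma not_isPerimeterMax_side_apex (hb : 0 < b) (hw : 0 < w) (ht0 : 0 < t)
    (ht1 : t < 1) (hr0 : 0 < r) (hrb : r < b)
    (hiso : (b + t * (u - b) - 0) ^ 2 + (t * w - 0) ^ 2 =
      (b + t * (u - b) - r) ^ 2 + (t * w - 0) ^ 2) :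
    ¬ IsPerimeterMax b u w (b + t * (u - b)) (t * w) 0 0 r 0 := by
  intro H
  have hr : r = 2 * (b + t * (u - b)) := by
    have : r * (r - 2 * (b + t * (u - b))) = 0 := by linear_combination -hiso
    have := (mul_eq_zero.1 this).resolve_left hr0.ne'
    linarith
  have c1 : Continuous fun s : ℝ => 2 * (b + s * (u - b)) := by fun_prop
  have hP : ∀ s, 0 < s → s < 1 → 0 < 2 * (b + s * (u - b)) → 2 * (b + s * (u - b)) < b →
      2 * √((b + s * (u - b)) ^ 2 + (s * w) ^ 2) + 2 * (b + s * (u - b)) ≤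
      2 * √((b + t * (u - b)) ^ 2 + (t * w) ^ 2) + 2 * (b + t * (u - b)) := by
    intro s hs0 hs1 h1 h2
    have := H _ _ 0 0 _ 0 (.side hb hw hs0.le hs1.le) (.axis hw le_rfl hb.le)
      (.axis hw h1.le h2.le) (by ring) (by
        have : det (b + s * (u - b)) (s * w) 0 0 (2 * (b + s * (u - b))) 0 =
          s * w * (2 * (b + s * (u - b))) := by simp only [det]; ring
        rw [this]; positivity)
    have e : ∀ a : ℝ, (0 - a) ^ 2 + (0 - 0) ^ 2 = a ^ 2 := fun a => by ring
    rw [hr, e, e, Real.sqrt_sq h1.le, Real.sqrt_sq (by linarith)] at this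
    simpa using this
  obtain ⟨ε, hε, ⟨⟨a1, a2⟩, a3, a4⟩, ⟨c1, c2⟩, c3, c4⟩ := ((eventually_side ht0 ht1).and
    ((c1.continuousAt.eventually (lt_mem_nhds (hr ▸ hr0))).and
      (c1.continuousAt.eventually (gt_mem_nhds (hr ▸ hrb))))).exists_symm_of_nhds
  have h1 := hP _ a1 a2 a3 a4
  have h2 := hP _ c1 c2 c3 c4
  have h3 := sqrt_add_sqrt_gt (a := b + (t + ε) * (u - b)) (b := (t + ε) * w)
    (c := b + (t - ε) * (u - b)) (d := (t - ε) * w) (by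
      have : (b + (t + ε) * (u - b)) * ((t - ε) * w) - (t + ε) * w * (b + (t - ε) * (u - b)) =
        -(2 * b * w * ε) := by ring
      rw [this]; exact neg_ne_zero.2 (by positivity))
  rw [show (b + (t + ε) * (u - b) + (b + (t - ε) * (u - b))) ^ 2 +
    ((t + ε) * w + (t - ε) * w) ^ 2 = 2 ^ 2 * ((b + t * (u - b)) ^ 2 + (t * w) ^ 2) by ring,
    Real.sqrt_mul (by norm_num), Real.sqrt_sq (by norm_num)] at h3
  linarith

/-- Hypothesis `ho` says that the base from `(0, 0)` to `(b, 0)` is seen from the side vertex at an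
angle of at least a right angle. Then `2 * r ≤ b`, and the isosceles triangle over the whole base
with apex on the midline has larger area. -/
lemma not_isAreaMax_axis_apex_of_obtuse (hb : 0 < b) (hw : 0 < w) (ht0 : 0 < t)
    (ht1 : t < 1) (hx : 0 < b + t * (u - b))
    (hr : 2 * r * (b + t * (u - b)) = (b + t * (u - b)) ^ 2 + (t * w) ^ 2)
    (ho : (b + t * (u - b)) ^ 2 + (t * w) ^ 2 ≤ b * (b + t * (u - b))) :
    ¬ IsAreaMax b u w r 0 0 0 (b + t * (u - b)) (t * w) := by
  intro H
  have hz : 0 < t * w := by positivity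
  have hxb : b + t * (u - b) < b := by nlinarith
  have hr0 : 0 < r := by
    by_contra! h
    nlinarith
  have hrb : 2 * r ≤ b := by
    by_contra! h
    nlinarith
  obtain ⟨h, hh, hin, hcase⟩ := InTri.exists_midline hb hw ht0 ht1 hx hxb
  have := H (b / 2) h 0 0 b 0 hin (.axis hw le_rfl hb.le) (.axis hw hb.le le_rfl) (by ring)
  simp only [det] at this
  have hlt : r * (t * w) < b * h := by
    have h1 : t * w < 2 * h := by
      rcases hcase with ⟨h1, h2⟩ | ⟨h1, h2⟩
      · by_contra! h3
        have : h * (2 * (b - (b + t * (u - b)))) < h * (2 * b) := by gcongr; linarith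
        nlinarith
      · by_contra! h3
        have : h * (2 * (b + t * (u - b))) < h * (2 * b) := by gcongr
        nlinarith
    nlinarith
  have : (r * (t * w)) ^ 2 < (b * h) ^ 2 := by gcongr
  nlinarith

/-- All three terms are small: `2 * r ≤ b` and the base is at most `b`. The midline competitor has
base `b` and legs each longer than `b / 2`. -/
lemma not_isPerimeterMax_axis_apex_of_obtuse (hb : 0 < b) (hw : 0 < w) (ht0 : 0 < t)
    (ht1 : t < 1) (hx : 0 < b + t * (u - b))
    (hr : 2 * r * (b + t * (u - b)) = (b + t * (u - b)) ^ 2 + (t * w) ^ 2)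
    (ho : (b + t * (u - b)) ^ 2 + (t * w) ^ 2 ≤ b * (b + t * (u - b))) :
    ¬ IsPerimeterMax b u w r 0 0 0 (b + t * (u - b)) (t * w) := by
  intro H
  have hz : 0 < t * w := by positivity
  have hxb : b + t * (u - b) < b := by nlinarith
  have hr0 : 0 < r := by
    by_contra! h
    nlinarith
  have hrb : 2 * r ≤ b := by
    by_contra! h
    nlinarith
  obtain ⟨h, hh, hin, -⟩ := InTri.exists_midline hb hw ht0 ht1 hx hxb
  have := H (b / 2) h 0 0 b 0 hin (.axis hw le_rfl hb.le) (.axis hw hb.le le_rfl) (by ring)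
    (by
      have : det (b / 2) h 0 0 b 0 = b * h := by simp only [det]; ring
      rw [this]; positivity)
  have e1 : √((0 - b) ^ 2 + (0 - 0) ^ 2) = b := by
    rw [show (0 - b) ^ 2 + (0 - 0) ^ 2 = b ^ 2 by ring, Real.sqrt_sq hb.le]
  have e2 : √((r - 0) ^ 2 + (0 - 0) ^ 2) = r := by
    rw [show (r - 0) ^ 2 + (0 - 0) ^ 2 = r ^ 2 by ring, Real.sqrt_sq hr0.le]
  have e3 : √((0 - (b + t * (u - b))) ^ 2 + (0 - t * w) ^ 2) ≤ b := by
    rw [Real.sqrt_le_left hb.le]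
    nlinarith
  have e4 : b / 2 < √((b / 2 - 0) ^ 2 + (h - 0) ^ 2) := by
    apply Real.lt_sqrt_of_sq_lt
    nlinarith [pow_pos hh 2]
  rw [e1, e2] at this
  linarith

/-- When the angle at the vertex on the side is acute, that vertex can be moved so that the leg
and the base angle increase. -/
lemma exists_axis_apex_of_acute (hb : 0 < b) (hw : 0 < w) (ht0 : 0 < t)
    (ht1 : t < 1) (hx : 0 < b + t * (u - b)) (hrb : r < b)
    (hr : 2 * r * (b + t * (u - b)) = (b + t * (u - b)) ^ 2 + (t * w) ^ 2)
    (ho : b * (b + t * (u - b)) < (b + t * (u - b)) ^ 2 + (t * w) ^ 2) :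
    ∃ s r', 0 < s ∧ s < 1 ∧ 0 < b + s * (u - b) ∧ 0 < r' ∧ r' < b ∧
      2 * r' * (b + s * (u - b)) = (b + s * (u - b)) ^ 2 + (s * w) ^ 2 ∧
      (b + t * (u - b)) ^ 2 + (t * w) ^ 2 < (b + s * (u - b)) ^ 2 + (s * w) ^ 2 ∧
      r * (t * w) < r' * (s * w) ∧ r < r' := by
  have c1 : Continuous fun s : ℝ => b + s * (u - b) := by fun_prop
  have c2 : ContinuousAt (fun s : ℝ => ((b + s * (u - b)) ^ 2 + (s * w) ^ 2) /
      (2 * (b + s * (u - b)))) t := by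
    have : 2 * (b + t * (u - b)) ≠ 0 := by positivity
    fun_prop (disch := assumption)
  have hr' : ((b + t * (u - b)) ^ 2 + (t * w) ^ 2) / (2 * (b + t * (u - b))) = r := by
    rw [div_eq_iff (by positivity)]; linarith
  obtain ⟨s, hts, ⟨hs0, hs1⟩, hsx, hsb⟩ := ((eventually_side ht0 ht1).and
    ((c1.continuousAt.eventually (lt_mem_nhds hx)).and
      (c2.eventually (gt_mem_nhds (hr'.trans_lt hrb))))).exists_gt_of_nhds
  set x := b + t * (u - b) with hxdef
  set X := b + s * (u - b) with hXdef
  have hN : x ^ 2 + (t * w) ^ 2 < X ^ 2 + (s * w) ^ 2 := by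
    -- The squared distance from the origin is quadratic along the side. Up to the factor `t`, its
    -- derivative at `t` is twice the quantity made positive by acuteness.
    have e : t * (X ^ 2 + (s * w) ^ 2 - (x ^ 2 + (t * w) ^ 2)) =
        (s - t) * (2 * (x ^ 2 + (t * w) ^ 2 - b * x)
          + t * (s - t) * ((u - b) ^ 2 + w ^ 2)) := by
      rw [hxdef, hXdef]; ring
    have h1 : 0 < s - t := sub_pos.2 hts
    have h2 : 0 < x ^ 2 + (t * w) ^ 2 - b * x := by linarith
    have h3 : 0 < t * (X ^ 2 + (s * w) ^ 2 - (x ^ 2 + (t * w) ^ 2)) := by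
      rw [e]; positivity
    have := pos_of_mul_pos_right h3 ht0.le
    linarith
  have hm : t * w * X < s * w * x := by
    have : s * w * x - t * w * X = w * b * (s - t) := by rw [hxdef, hXdef]; ring
    have h1 : 0 < w * b * (s - t) := mul_pos (mul_pos hw hb) (sub_pos.2 hts)
    linarith
  have ez : 2 * (((X ^ 2 + (s * w) ^ 2) / (2 * X))) * X = X ^ 2 + (s * w) ^ 2 := by field_simp
  set r' := (X ^ 2 + (s * w) ^ 2) / (2 * X)
  have hr'0 : 0 < r' := by positivity
  have hz : 0 < t * w := by positivity
  have hZ : 0 < s * w := by positivity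
  refine ⟨s, r', hs0, hs1, hsx, hr'0, hsb, ez, hN, ?_, ?_⟩
  · have h1 : (x ^ 2 + (t * w) ^ 2) * (t * w * X) < (X ^ 2 + (s * w) ^ 2) * (s * w * x) := by
      gcongr
    have h2 : (r * (t * w)) * (2 * x * X) < (r' * (s * w)) * (2 * x * X) := by
      rw [← hr, ← ez] at h1
      linarith
    exact lt_of_mul_lt_mul_right h2 (by positivity)
  -- The leg is half the distance to the origin divided by the cosine of the base angle. Both the
  -- distance and the slope increase, which is compared here after squaring to avoid roots.
  · have e1 : (2 * r * x) ^ 2 = (x ^ 2 + (t * w) ^ 2) * (x ^ 2 + (t * w) ^ 2) := by rw [hr]; ring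
    have e2 : (2 * r' * X) ^ 2 = (X ^ 2 + (s * w) ^ 2) * (X ^ 2 + (s * w) ^ 2) := by rw [ez]; ring
    have h0 : (t * w * X) ^ 2 < (s * w * x) ^ 2 := by gcongr
    have h1 : (x ^ 2 + (t * w) ^ 2) * X ^ 2 < (X ^ 2 + (s * w) ^ 2) * x ^ 2 := by linarith
    have h2 := mul_lt_mul'' hN h1 (by positivity) (by positivity)
    have k1 : r ^ 2 * (4 * x ^ 2 * X ^ 2) =
        (x ^ 2 + (t * w) ^ 2) * ((x ^ 2 + (t * w) ^ 2) * X ^ 2) := by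
      linear_combination X ^ 2 * e1
    have k2 : r' ^ 2 * (4 * x ^ 2 * X ^ 2) =
        (X ^ 2 + (s * w) ^ 2) * ((X ^ 2 + (s * w) ^ 2) * x ^ 2) := by
      linear_combination x ^ 2 * e2
    rw [← k1, ← k2] at h2
    exact lt_of_pow_lt_pow_left₀ 2 hr'0.le (lt_of_mul_lt_mul_right h2 (by positivity))

lemma not_isAreaMax_axis_apex (hb : 0 < b) (hw : 0 < w) (ht0 : 0 < t)
    (ht1 : t < 1) (hr0 : 0 < r) (hrb : r < b)
    (hiso : (r - 0) ^ 2 + (0 - 0) ^ 2 = (r - (b + t * (u - b))) ^ 2 + (0 - t * w) ^ 2) :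
    ¬ IsAreaMax b u w r 0 0 0 (b + t * (u - b)) (t * w) := by
  have hz : 0 < t * w := by positivity
  have hr : 2 * r * (b + t * (u - b)) = (b + t * (u - b)) ^ 2 + (t * w) ^ 2 := by linarith
  have hx : 0 < b + t * (u - b) := by
    by_contra! h
    nlinarith [sq_nonneg (b + t * (u - b)), pow_pos hz 2]
  rcases le_or_gt ((b + t * (u - b)) ^ 2 + (t * w) ^ 2) (b * (b + t * (u - b))) with ho | ho
  · exact not_isAreaMax_axis_apex_of_obtuse hb hw ht0 ht1 hx hr ho
  intro H
  obtain ⟨s, r', hs0, hs1, hX, hr'0, hr'b, hr', -, hlt, -⟩ :=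
    exists_axis_apex_of_acute hb hw ht0 ht1 hx hrb hr ho
  have := H r' 0 0 0 _ _ (.axis hw hr'0.le hr'b.le) (.axis hw le_rfl hb.le)
    (.side hb hw hs0.le hs1.le) (by linear_combination hr')
  simp only [det] at this
  have h2 : (r * (t * w)) ^ 2 < (r' * (s * w)) ^ 2 := by gcongr
  nlinarith

lemma not_isPerimeterMax_axis_apex (hb : 0 < b) (hw : 0 < w) (ht0 : 0 < t)
    (ht1 : t < 1) (hr0 : 0 < r) (hrb : r < b)
    (hiso : (r - 0) ^ 2 + (0 - 0) ^ 2 = (r - (b + t * (u - b))) ^ 2 + (0 - t * w) ^ 2) :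
    ¬ IsPerimeterMax b u w r 0 0 0 (b + t * (u - b)) (t * w) := by
  have hz : 0 < t * w := by positivity
  have hr : 2 * r * (b + t * (u - b)) = (b + t * (u - b)) ^ 2 + (t * w) ^ 2 := by linarith
  have hx : 0 < b + t * (u - b) := by
    by_contra! h
    nlinarith [sq_nonneg (b + t * (u - b)), pow_pos hz 2]
  rcases le_or_gt ((b + t * (u - b)) ^ 2 + (t * w) ^ 2) (b * (b + t * (u - b))) with ho | ho
  · exact not_isPerimeterMax_axis_apex_of_obtuse hb hw ht0 ht1 hx hr ho
  intro H
  obtain ⟨s, r', hs0, hs1, hX, hr'0, hr'b, hr', hN, -, hlt⟩ :=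
    exists_axis_apex_of_acute hb hw ht0 ht1 hx hrb hr ho
  have := H r' 0 0 0 _ _ (.axis hw hr'0.le hr'b.le) (.axis hw le_rfl hb.le)
    (.side hb hw hs0.le hs1.le) (by linear_combination hr') (by
      have : det r' 0 0 0 (b + s * (u - b)) (s * w) = -(r' * (s * w)) := by simp only [det]; ring
      rw [this]; exact neg_ne_zero.2 (by positivity))
  have k1 : √((0 - (b + t * (u - b))) ^ 2 + (0 - t * w) ^ 2) <
      √((0 - (b + s * (u - b))) ^ 2 + (0 - s * w) ^ 2) :=
    Real.sqrt_lt_sqrt (by positivity) (by linarith)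
  have k2 : √((r - 0) ^ 2 + (0 - 0) ^ 2) < √((r' - 0) ^ 2 + (0 - 0) ^ 2) :=
    Real.sqrt_lt_sqrt (by positivity) (by nlinarith)
  linarith

/-- A local maximum along the side forces `2 (x ^ 2 + z ^ 2) = b x` for the side vertex `(x, z)`.
Hence both `x` and `r` are below `b / 2`, and the midline triangle over the full base has larger
area. -/
lemma not_isAreaMax_origin_apex (hb : 0 < b) (hw : 0 < w) (ht0 : 0 < t)
    (ht1 : t < 1) (hr0 : 0 < r) (hrb : r < b)
    (hiso : (0 - r) ^ 2 + (0 - 0) ^ 2 = (0 - (b + t * (u - b))) ^ 2 + (0 - t * w) ^ 2) :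
    ¬ IsAreaMax b u w 0 0 r 0 (b + t * (u - b)) (t * w) := by
  intro H
  have hz : 0 < t * w := by positivity
  have hr : r = √((b + t * (u - b)) ^ 2 + (t * w) ^ 2) := by
    rw [eq_comm, Real.sqrt_eq_iff_mul_self_eq (by positivity) hr0.le]
    linarith
  have c1 : Continuous fun s : ℝ => √((b + s * (u - b)) ^ 2 + (s * w) ^ 2) := by fun_prop
  have hmax : IsLocalMax (fun s => w ^ 2 * (((b + s * (u - b)) ^ 2 + (s * w) ^ 2) * s ^ 2)) t := by
    filter_upwards [eventually_side ht0 ht1,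
      c1.continuousAt.eventually (gt_mem_nhds (hr ▸ hrb))] with s hs h2
    have e := Real.sq_sqrt (show 0 ≤ (b + s * (u - b)) ^ 2 + (s * w) ^ 2 by positivity)
    have := H 0 0 _ 0 _ _ (.axis hw le_rfl hb.le) (.axis hw (Real.sqrt_nonneg _) h2.le)
      (.side hb hw hs.1.le hs.2.le) (by linear_combination e)
    simp only [det] at this
    have k1 : ∀ s r : ℝ, r ^ 2 = (b + s * (u - b)) ^ 2 + (s * w) ^ 2 →
        ((r - 0) * (s * w - 0) - (0 - 0) * (b + s * (u - b) - 0)) ^ 2 =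
        w ^ 2 * (((b + s * (u - b)) ^ 2 + (s * w) ^ 2) * s ^ 2) := by
      intro s r h; linear_combination w ^ 2 * s ^ 2 * h
    rwa [k1 s _ e, k1 t r (by linarith)] at this
  have hd : HasDerivAt (fun s : ℝ => w ^ 2 * (((b + s * (u - b)) ^ 2 + (s * w) ^ 2) * s ^ 2))
      (w ^ 2 * ((2 * (b + t * (u - b)) * (u - b) + 2 * (t * w) * w) * t ^ 2 +
        ((b + t * (u - b)) ^ 2 + (t * w) ^ 2) * (2 * t))) t := by
    have h1 := ((((hasDerivAt_id t).mul_const (u - b)).const_add b).pow 2).add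
      (((hasDerivAt_id t).mul_const w).pow 2)
    refine ((h1.mul ((hasDerivAt_id t).pow 2)).const_mul (w ^ 2)).congr_deriv ?_
    simp
  have h0 := hmax.hasDerivAt_eq_zero hd
  have h1 : 2 * w ^ 2 * t * (2 * ((b + t * (u - b)) ^ 2 + (t * w) ^ 2) - b * (b + t * (u - b)))
      = 0 := by linear_combination h0
  have h2 := (mul_eq_zero.1 h1).resolve_left (by positivity)
  set x := b + t * (u - b) with hx
  have hz2 := pow_pos hz 2
  have hx0 : 0 < x := by
    by_contra! h
    nlinarith [sq_nonneg x]
  have hx2 : x < b / 2 := by nlinarith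
  obtain ⟨h, hh, hin, hcase⟩ := InTri.exists_midline hb hw ht0 ht1 (hx ▸ hx0) (by linarith)
  obtain ⟨-, hcase⟩ := hcase.resolve_right (fun h => by linarith [h.1])
  have := H (b / 2) h 0 0 b 0 hin (.axis hw le_rfl hb.le) (.axis hw hb.le le_rfl) (by ring)
  simp only [det] at this
  rw [← hx] at hcase
  have hlt : r * (t * w) < b * h := by
    have h3 : t * w < 2 * h := by nlinarith
    have h4 : 2 * r < b := by nlinarith
    nlinarith
  have : (r * (t * w)) ^ 2 < (b * h) ^ 2 := by gcongr
  nlinarith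

/-- With polar angle `2 * a`, the base is `2 ρ sin a`, so half the perimeter is `ρ (1 + sin a)`. -/
lemma exists_half_angle {x z : ℝ} (hz : 0 < z) : ∃ ρ a, 0 < ρ ∧ 0 < a ∧ a < Real.pi / 2 ∧
    √(x ^ 2 + z ^ 2) = ρ ∧ x = ρ * Real.cos (2 * a) ∧ z = ρ * Real.sin (2 * a) ∧
    2 * √((0 - ρ) ^ 2 + (0 - 0) ^ 2) + √((ρ - x) ^ 2 + (0 - z) ^ 2) =
      2 * (ρ * (1 + Real.sin a)) := by
  have hρ : 0 < √(x ^ 2 + z ^ 2) := Real.sqrt_pos.2 (by positivity)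
  obtain ⟨θ, h0, hπ, h1, h2⟩ := exists_polar hρ hz (Real.sq_sqrt (by positivity)).symm
  set ρ := √(x ^ 2 + z ^ 2)
  have e : 2 * (θ / 2) = θ := by ring
  have hs : 0 < Real.sin (θ / 2) := Real.sin_pos_of_pos_of_lt_pi (by linarith) (by linarith)
  refine ⟨ρ, θ / 2, hρ, by linarith, by linarith, rfl, by rw [e, h1], by rw [e, h2], ?_⟩
  have k1 : (0 - ρ) ^ 2 + (0 - 0) ^ 2 = ρ ^ 2 := by ring
  have k2 : (ρ - x) ^ 2 + (0 - z) ^ 2 = (2 * ρ * Real.sin (θ / 2)) ^ 2 := by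
    have c := Real.cos_two_mul (θ / 2)
    rw [e] at c
    have p1 := Real.sin_sq_add_cos_sq θ
    have p2 := Real.sin_sq_add_cos_sq (θ / 2)
    rw [h1, h2]
    linear_combination ρ ^ 2 * p1 - 2 * ρ ^ 2 * c - 4 * ρ ^ 2 * p2
  rw [k1, k2, Real.sqrt_sq hρ.le, Real.sqrt_sq (by positivity)]
  ring

/-- The tangent lines of `a ↦ 1 + sin a`, as a function of the double angle in polar
coordinates, lie below it. -/
lemma tangent_lt_one_add_sin {a a' : ℝ} (h0 : 0 < a) (h1 : a < Real.pi / 2) (h0' : 0 < a')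
    (h1' : a' < Real.pi / 2) (hne : a ≠ a') :
    (1 + Real.sin a) * (Real.cos (2 * a') * Real.cos (2 * a) + Real.sin (2 * a') * Real.sin (2 * a))
      + Real.cos a / 2 * (Real.sin (2 * a') * Real.cos (2 * a) -
        Real.cos (2 * a') * Real.sin (2 * a)) < 1 + Real.sin a' := by
  obtain ⟨η, rfl⟩ : ∃ η, a' = a + η := ⟨a' - a, by ring⟩
  have hη : η ≠ 0 := by rintro rfl; simp at hne
  rw [← Real.cos_sub, ← Real.sin_sub, show 2 * (a + η) - 2 * a = 2 * η by ring, Real.cos_two_mul,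
    Real.sin_two_mul, Real.sin_add]
  have hs : 0 < Real.sin a := Real.sin_pos_of_pos_of_lt_pi h0 (by linarith [Real.pi_pos])
  have hc : 0 < Real.cos a := Real.cos_pos_of_mem_Ioo ⟨by linarith, h1⟩
  have hk : 0 < Real.cos η := Real.cos_pos_of_mem_Ioo ⟨by linarith, by linarith⟩
  have hsη : Real.sin η ≠ 0 := by
    intro h
    rw [Real.sin_eq_zero_iff_of_lt_of_lt (by linarith) (by linarith)] at h
    exact hη h
  have p := Real.sin_sq_add_cos_sq η
  have pa := Real.sin_sq_add_cos_sq a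
  have hs2 : 0 < Real.sin η ^ 2 := by positivity
  have hk1 : Real.cos η < 1 := by nlinarith
  have hsl : -1 ≤ Real.sin η := Real.neg_one_le_sin η
  have hca : Real.cos a ≤ 1 := Real.cos_le_one a
  set S := Real.sin η
  set K := Real.cos η
  -- The right side minus the left side of the goal factors as `(1 - K) (2 (1 + K) + sin a (1 + 2 K)
  -- + S cos a)`, and `S cos a ≥ -1`.
  have t1 : 0 ≤ Real.sin a * ((1 - K) * (1 + 2 * K)) := by
    have : 0 < 1 - K := by linarith
    positivity
  have t2 : -(Real.cos a * (1 - K)) ≤ Real.cos a * (1 - K) * S := by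
    nlinarith [mul_nonneg hc.le (sub_nonneg.2 hk1.le)]
  have t3 : Real.cos a * (1 - K) ≤ 1 - K := by nlinarith
  nlinarith

/-- Half the perimeter, as a function of the side vertex, is positively homogeneous and has a
supporting linear form at the given vertex. It lies strictly above this form at nearby points of the
side, so the vertex is not a maximum. -/
lemma not_isPerimeterMax_origin_apex (hb : 0 < b) (hw : 0 < w) (ht0 : 0 < t)
    (ht1 : t < 1) (hr0 : 0 < r) (hrb : r < b)
    (hiso : (0 - r) ^ 2 + (0 - 0) ^ 2 = (0 - (b + t * (u - b))) ^ 2 + (0 - t * w) ^ 2) :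
    ¬ IsPerimeterMax b u w 0 0 r 0 (b + t * (u - b)) (t * w) := by
  intro H
  obtain ⟨ρ, a, hρ, ha0, haπ, hsq, hxa, hza, hP⟩ := exists_half_angle
    (x := b + t * (u - b)) (z := t * w) (by positivity)
  obtain rfl : r = ρ := by
    rw [eq_comm, ← hsq, Real.sqrt_eq_iff_mul_self_eq (by positivity) hr0.le]
    linarith
  have c1 : Continuous fun s : ℝ => √((b + s * (u - b)) ^ 2 + (s * w) ^ 2) := by fun_prop
  -- The left side is the supporting linear form evaluated at a side point; it is bounded strictly
  -- by that point's half-perimeter, which maximality bounds by the original one.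
  have key : ∀ s, 0 < s → s < 1 → s ≠ t → √((b + s * (u - b)) ^ 2 + (s * w) ^ 2) < b →
      (1 + Real.sin a) * ((b + s * (u - b)) * Real.cos (2 * a) + s * w * Real.sin (2 * a))
      + Real.cos a / 2 * (s * w * Real.cos (2 * a) -
        (b + s * (u - b)) * Real.sin (2 * a)) < r * (1 + Real.sin a) := by
    intro s hs0 hs1 hst hsb
    obtain ⟨ρ', a', hρ', ha'0, ha'π, hsq', hxa', hza', hP'⟩ := exists_half_angle
      (x := b + s * (u - b)) (z := s * w) (by positivity)
    rw [hsq'] at hsb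
    have e := Real.sq_sqrt (show 0 ≤ (b + s * (u - b)) ^ 2 + (s * w) ^ 2 by positivity)
    rw [hsq'] at e
    have := H 0 0 ρ' 0 _ _ (.axis hw le_rfl hb.le) (.axis hw hρ'.le hsb.le)
      (.side hb hw hs0.le hs1.le) (by linear_combination e) (by
        have : det 0 0 ρ' 0 (b + s * (u - b)) (s * w) = ρ' * (s * w) := by simp only [det]; ring
        rw [this]; positivity)
    rw [hP, hP'] at this
    have hne : a ≠ a' := by
      rintro rfl
      have : (b + t * (u - b)) * (s * w) - (t * w) * (b + s * (u - b)) = 0 := by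
        rw [hxa, hza, hxa', hza']; ring
      have : b * w * (s - t) = 0 := by linear_combination this
      exact hst (sub_eq_zero.1 ((mul_eq_zero.1 this).resolve_left (by positivity)))
    have ht := mul_lt_mul_of_pos_left (tangent_lt_one_add_sin ha0 haπ ha'0 ha'π hne) hρ'
    refine lt_of_lt_of_le (lt_of_eq_of_lt ?_ ht) (by linarith)
    rw [hxa', hza']; ring
  obtain ⟨ε, hε, ⟨⟨a1, a2⟩, a3⟩, ⟨c1, c2⟩, c3⟩ := ((eventually_side ht0 ht1).and
      (c1.continuousAt.eventually (gt_mem_nhds (hsq.trans_lt hrb)))).exists_symm_of_nhds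
  have h1 := key _ a1 a2 (by linarith) a3
  have h2 := key _ c1 c2 (by linarith) c3
  have p := Real.sin_sq_add_cos_sq (2 * a)
  -- The form attains the bound at `t` and is affine along the side, so strict inequalities at `t +
  -- ε` and `t - ε` cannot both hold.
  have h3 : (1 + Real.sin a) * ((b + t * (u - b)) * Real.cos (2 * a) + t * w * Real.sin (2 * a))
      + Real.cos a / 2 * (t * w * Real.cos (2 * a) -
        (b + t * (u - b)) * Real.sin (2 * a)) = r * (1 + Real.sin a) := by
    rw [hxa, hza]
    linear_combination r * (1 + Real.sin a) * p
  linarith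

end

/-! ### Assembling the exclusions with the incidence cases -/

/-- A property of isosceles triangles in coordinates (apex first) that fails for those inscribed
in the triangle `(0, 0)`, `(b, 0)`, `(u, w)` without sharing a side and an angle with it. -/
structure ExcludesUnshared (Φ : ℝ → ℝ → ℝ → ℝ → ℝ → ℝ → ℝ → ℝ → ℝ → Prop) : Prop where
  interior_apex : ∀ {b u w x z : ℝ}, 0 < b → 0 < w → 0 < z → 0 < w * x - u * z →
    0 < w * (b - x) + (u - b) * z →
    (x - 0) ^ 2 + (z - 0) ^ 2 = (x - b) ^ 2 + (z - 0) ^ 2 → ¬ Φ b u w x z 0 0 b 0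
  interior_base : ∀ {b u w x z : ℝ}, 0 < b → 0 < w → 0 < z → 0 < w * x - u * z →
    0 < w * (b - x) + (u - b) * z →
    (0 - b) ^ 2 + (0 - 0) ^ 2 = (0 - x) ^ 2 + (0 - z) ^ 2 → ¬ Φ b u w 0 0 b 0 x z
  apex_opposite : ∀ {b u w q r : ℝ}, 0 < w → 0 < q → q < b → 0 < r → r < b → q ≠ r →
    (u - q) ^ 2 + (w - 0) ^ 2 = (u - r) ^ 2 + (w - 0) ^ 2 → ¬ Φ b u w u w q 0 r 0
  base_on_axis : ∀ {b u w q r : ℝ}, 0 < w → 0 < q → q < b → 0 < r → r < b →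
    (q - u) ^ 2 + (0 - w) ^ 2 = (q - r) ^ 2 + (0 - 0) ^ 2 → ¬ Φ b u w q 0 u w r 0
  side_apex : ∀ {b u w t r : ℝ}, 0 < b → 0 < w → 0 < t → t < 1 → 0 < r → r < b →
    (b + t * (u - b) - 0) ^ 2 + (t * w - 0) ^ 2 =
      (b + t * (u - b) - r) ^ 2 + (t * w - 0) ^ 2 →
    ¬ Φ b u w (b + t * (u - b)) (t * w) 0 0 r 0
  axis_apex : ∀ {b u w t r : ℝ}, 0 < b → 0 < w → 0 < t → t < 1 → 0 < r → r < b →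
    (r - 0) ^ 2 + (0 - 0) ^ 2 = (r - (b + t * (u - b))) ^ 2 + (0 - t * w) ^ 2 →
    ¬ Φ b u w r 0 0 0 (b + t * (u - b)) (t * w)
  origin_apex : ∀ {b u w t r : ℝ}, 0 < b → 0 < w → 0 < t → t < 1 → 0 < r → r < b →
    (0 - r) ^ 2 + (0 - 0) ^ 2 = (0 - (b + t * (u - b))) ^ 2 + (0 - t * w) ^ 2 →
    ¬ Φ b u w 0 0 r 0 (b + t * (u - b)) (t * w)

lemma excludesUnshared_isAreaMax : ExcludesUnshared IsAreaMax :=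
  ⟨not_isAreaMax_interior_apex, not_isAreaMax_interior_base, not_isAreaMax_apex_opposite,
    not_isAreaMax_base_on_axis, not_isAreaMax_side_apex, not_isAreaMax_axis_apex,
    not_isAreaMax_origin_apex⟩

lemma excludesUnshared_isPerimeterMax : ExcludesUnshared IsPerimeterMax :=
  ⟨not_isPerimeterMax_interior_apex, not_isPerimeterMax_interior_base,
    not_isPerimeterMax_apex_opposite, not_isPerimeterMax_base_on_axis,
    not_isPerimeterMax_side_apex, not_isPerimeterMax_axis_apex, not_isPerimeterMax_origin_apex⟩

namespace IsFrame

variable {D : PlaneTriangle} {i j k : Fin 3} {b u w : ℝ} {φ : ℝ → ℝ → Plane}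

lemma dist_eq_dist_iff {A C B : Plane} (h : IsFrame A C B b u w φ) {x₀ y₀ x₁ y₁ x₂ y₂ : ℝ} :
    dist (φ x₀ y₀) (φ x₁ y₁) = dist (φ x₀ y₀) (φ x₂ y₂) ↔
      (x₀ - x₁) ^ 2 + (y₀ - y₁) ^ 2 = (x₀ - x₂) ^ 2 + (y₀ - y₂) ^ 2 := by
  rw [h.dist_eq, h.dist_eq, Real.sqrt_inj (by positivity) (by positivity)]

lemma bary_first_pos_iff (h : IsFrame (D.points i) (D.points j) (D.points k) b u w φ)
    (hij : i ≠ j) (hik : i ≠ k) (hjk : j ≠ k) {x y : ℝ} :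
    0 < D.bary i (φ x y) ↔ 0 < w * (b - x) + (u - b) * y := by
  rw [h.bary_first hij hik hjk, div_pos_iff_of_pos_right (mul_pos h.hw h.hb)]

lemma bary_second_pos_iff (h : IsFrame (D.points i) (D.points j) (D.points k) b u w φ)
    (hij : i ≠ j) (hik : i ≠ k) (hjk : j ≠ k) {x y : ℝ} :
    0 < D.bary j (φ x y) ↔ 0 < w * x - u * y := by
  rw [h.bary_second hij hik hjk, div_pos_iff_of_pos_right (mul_pos h.hw h.hb)]

lemma bary_third_pos_iff (h : IsFrame (D.points i) (D.points j) (D.points k) b u w φ)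
    (hij : i ≠ j) (hik : i ≠ k) (hjk : j ≠ k) {x y : ℝ} :
    0 < D.bary k (φ x y) ↔ 0 < y := by
  rw [h.bary_third hij hik hjk, div_pos_iff_of_pos_right h.hw]

lemma exists_eq_axis (h : IsFrame (D.points i) (D.points j) (D.points k) b u w φ)
    (hij : i ≠ j) (hik : i ≠ k) (hjk : j ≠ k) {P : Plane} (hi : 0 < D.bary i P)
    (hj : 0 < D.bary j P) (hk : D.bary k P = 0) : ∃ r, 0 < r ∧ r < b ∧ P = φ r 0 := by
  obtain ⟨x, y, rfl⟩ := h.surj P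
  have hw := h.hw
  rw [h.bary_third hij hik hjk, div_eq_zero_iff, or_iff_left hw.ne'] at hk
  subst hk
  rw [h.bary_first_pos_iff hij hik hjk, mul_zero, add_zero] at hi
  rw [h.bary_second_pos_iff hij hik hjk, mul_zero, sub_zero] at hj
  exact ⟨x, pos_of_mul_pos_right hj hw.le, sub_pos.1 (pos_of_mul_pos_right hi hw.le), rfl⟩

lemma exists_eq_side (h : IsFrame (D.points i) (D.points j) (D.points k) b u w φ)
    (hij : i ≠ j) (hik : i ≠ k) (hjk : j ≠ k) {P : Plane} (hi : D.bary i P = 0)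
    (hj : 0 < D.bary j P) (hk : 0 < D.bary k P) :
    ∃ t, 0 < t ∧ t < 1 ∧ P = φ (b + t * (u - b)) (t * w) := by
  obtain ⟨x, y, rfl⟩ := h.surj P
  have hw := h.hw
  have hb := h.hb
  rw [h.bary_third_pos_iff hij hik hjk] at hk
  rw [h.bary_first hij hik hjk, div_eq_zero_iff, or_iff_left (by positivity)] at hi
  rw [h.bary_second_pos_iff hij hik hjk] at hj
  have hx : x = b + y / w * (u - b) := by
    field_simp
    linarith
  refine ⟨y / w, by positivity, ?_, ?_⟩
  · rw [div_lt_one hw]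
    have : w * x - u * y = b * (w - y) := by linear_combination -hi
    rw [this] at hj
    exact sub_pos.1 (pos_of_mul_pos_right hj hb.le)
  · rw [← hx, div_mul_cancel₀ _ hw.ne']

end IsFrame

namespace PlaneTriangle

lemma bary_smul_add_of_ne (D : PlaneTriangle) {i j k : Fin 3} (hij : i ≠ j) (hik : i ≠ k)
    (hjk : j ≠ k) (P : Plane) :
    P = D.bary i P • D.points i + D.bary j P • D.points j + D.bary k P • D.points k := by
  conv_lhs => rw [D.bary_smul_add P]
  fin_cases i <;> fin_cases j <;> fin_cases k <;> simp at hij hik hjk ⊢ <;> abel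

lemma sum_bary_of_ne (D : PlaneTriangle) {i j k : Fin 3} (hij : i ≠ j) (hik : i ≠ k)
    (hjk : j ≠ k) (P : Plane) : D.bary i P + D.bary j P + D.bary k P = 1 := by
  rw [← D.sum_bary P]
  fin_cases i <;> fin_cases j <;> fin_cases k <;> simp at hij hik hjk ⊢ <;> ring

/-- The third vertex of `T` lies on the side of `D` joining vertices `i` and `k`, away from `i`.
Thus both angles at `i` are bounded by the same two rays. -/
lemma shareSideAndAngle_of_bary_eq_zero {D T : PlaneTriangle} (h : T.region ⊆ D.region)
    {a b c i j k : Fin 3} (habc : a ≠ b ∧ a ≠ c ∧ b ≠ c) (hijk : i ≠ j ∧ i ≠ k ∧ j ≠ k)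
    (ha : T.points a = D.points i) (hb : T.points b = D.points j)
    (hc : D.bary j (T.points c) = 0) : T.ShareSideAndAngle D := by
  refine ⟨a, b, c, i, j, k, habc, hijk, ha, hb, ?_⟩
  obtain ⟨hij, hik, hjk⟩ := hijk
  have hk : 0 < D.bary k (T.points c) := by
    refine lt_of_le_of_ne (bary_nonneg h k c) fun h0 => ?_
    have := D.eq_points_of_bary_eq_zero hij hik hjk hc h0.symm
    exact habc.2.1 (T.independent.injective (ha.trans this.symm))
  have hs := D.sum_bary_of_ne hij hik hjk (T.points c)
  have hP : T.points c - D.points i = D.bary k (T.points c) • (D.points k - D.points i) := by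
    conv_lhs => rw [D.bary_smul_add_of_ne hij hik hjk (T.points c)]
    rw [hc, show D.bary i (T.points c) = 1 - D.bary k (T.points c) by linarith]
    module
  rw [ha, hb, EuclideanGeometry.angle, EuclideanGeometry.angle, vsub_eq_sub, vsub_eq_sub,
    vsub_eq_sub, hP, InnerProductGeometry.angle_smul_right_of_pos _ _ hk]

lemma Isosceles.cases {T : PlaneTriangle} (h : T.Isosceles) {a b c : Fin 3} (hab : a ≠ b)
    (hac : a ≠ c) (hbc : b ≠ c) :
    dist (T.points a) (T.points b) = dist (T.points a) (T.points c) ∨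
    dist (T.points b) (T.points a) = dist (T.points b) (T.points c) ∨
    dist (T.points c) (T.points a) = dist (T.points c) (T.points b) := by
  obtain ⟨i, j, k, hij, hik, hjk, e⟩ := h
  have hi : i = a ∨ i = b ∨ i = c := by omega
  have hj : j = a ∨ j = b ∨ j = c := by omega
  have hk : k = a ∨ k = b ∨ k = c := by omega
  rcases hi with rfl | rfl | rfl <;> rcases hj with rfl | rfl | rfl <;>
    rcases hk with rfl | rfl | rfl <;> first | contradiction | simp [e]

/-- Abstracting the maximality predicate as `Φ` lets area and perimeter share this case analysis.
The frame is chosen by incidence pattern, while the arguments of `Φ` are ordered by which vertex is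
the apex. -/
theorem shareSideAndAngle_of_excludesUnshared {D T : PlaneTriangle} (h : T.region ⊆ D.region)
    (hiso : T.Isosceles) (hN : D.NoLargerCopy T)
    {Φ : ℝ → ℝ → ℝ → ℝ → ℝ → ℝ → ℝ → ℝ → ℝ → Prop} (hex : ExcludesUnshared Φ)
    (hΦ : ∀ {a b c i j k : Fin 3}, a ≠ b → a ≠ c → b ≠ c → i ≠ j → i ≠ k → j ≠ k →
      dist (T.points a) (T.points b) = dist (T.points a) (T.points c) →
      ∀ {β u w φ}, IsFrame (D.points i) (D.points j) (D.points k) β u w φ →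
      ∀ {x₀ y₀ x₁ y₁ x₂ y₂}, T.points a = φ x₀ y₀ → T.points b = φ x₁ y₁ →
        T.points c = φ x₂ y₂ → Φ β u w x₀ y₀ x₁ y₁ x₂ y₂) :
    T.ShareSideAndAngle D := by
  obtain ⟨a, b, c, i, j, k, habc, hijk, H⟩ := hN.cases h
  obtain ⟨hab, hac, hbc⟩ := id habc
  obtain ⟨hij, hik, hjk⟩ := id hijk
  rcases H with ⟨h1, h2, h3⟩ | ⟨h1, h2, h3⟩ | ⟨h1, ⟨h2, h3, h4⟩, h5, h6, h7⟩ |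
    ⟨h1, ⟨h2, h3, h4⟩, h5, h6, h7⟩
  · exact shareSideAndAngle_of_bary_eq_zero h habc hijk h1 h2 h3
  · exfalso
    -- The apex may be either endpoint of the common side; stating this for arbitrary labels covers
    -- both by symmetry.
    have base : ∀ {a b i j : Fin 3}, a ≠ b → a ≠ c → b ≠ c → i ≠ j → i ≠ k → j ≠ k →
        T.points a = D.points i → T.points b = D.points j →
        dist (T.points a) (T.points b) ≠ dist (T.points a) (T.points c) := by
      intro a b i j hab hac hbc hij hik hjk h1 h2 hd
      obtain ⟨β, u, w, φ, hφ⟩ := exists_isFrame (D.cross_points_ne_zero_of_ne hij hik hjk)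
      obtain ⟨x, z, hxz⟩ := hφ.surj (T.points c)
      have hd' := hd
      have := hΦ hab hac hbc hij hik hjk hd hφ (h1.trans hφ.map_A.symm) (h2.trans hφ.map_C.symm)
        hxz.symm
      rw [h1, h2, ← hφ.map_A, ← hφ.map_C, ← hxz, hφ.dist_eq_dist_iff] at hd
      rw [← hxz] at h3
      exact hex.interior_base hφ.hb hφ.hw ((hφ.bary_third_pos_iff hij hik hjk).1 (h3 k))
        ((hφ.bary_second_pos_iff hij hik hjk).1 (h3 j))
        ((hφ.bary_first_pos_iff hij hik hjk).1 (h3 i)) hd this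
    rcases hiso.cases hab hac hbc with hd | hd | hd
    · exact base hab hac hbc hij hik hjk h1 h2 hd
    · exact base hab.symm hbc hac hij.symm hjk hik h2 h1 hd
    · obtain ⟨β, u, w, φ, hφ⟩ := exists_isFrame (D.cross_points_ne_zero_of_ne hij hik hjk)
      obtain ⟨x, z, hxz⟩ := hφ.surj (T.points c)
      have := hΦ hac.symm hbc.symm hab hij hik hjk hd hφ hxz.symm (h1.trans hφ.map_A.symm)
        (h2.trans hφ.map_C.symm)
      rw [h1, h2, ← hφ.map_A, ← hφ.map_C, ← hxz, hφ.dist_eq_dist_iff] at hd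
      rw [← hxz] at h3
      exact hex.interior_apex hφ.hb hφ.hw ((hφ.bary_third_pos_iff hij hik hjk).1 (h3 k))
        ((hφ.bary_second_pos_iff hij hik hjk).1 (h3 j))
        ((hφ.bary_first_pos_iff hij hik hjk).1 (h3 i)) hd this
  · exfalso
    -- The shared vertex is placed at `(u, w)`, so the other two vertices of `T` lie on the first
    -- axis.
    obtain ⟨β, u, w, φ, hφ⟩ := exists_isFrame
      (D.cross_points_ne_zero_of_ne hjk hij.symm hik.symm)
    obtain ⟨q, hq0, hqβ, hq⟩ := hφ.exists_eq_axis hjk hij.symm hik.symm h3 h4 h2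
    obtain ⟨r, hr0, hrβ, hr⟩ := hφ.exists_eq_axis hjk hij.symm hik.symm h6 h7 h5
    rw [← hφ.map_B] at h1
    have hqr : q ≠ r := by
      rintro rfl
      exact hbc (T.independent.injective (hq.trans hr.symm))
    rcases hiso.cases hab hac hbc with hd | hd | hd
    · have := hΦ hab hac hbc hjk hij.symm hik.symm hd hφ h1 hq hr
      rw [h1, hq, hr, hφ.dist_eq_dist_iff] at hd
      exact hex.apex_opposite hφ.hw hq0 hqβ hr0 hrβ hqr hd this
    · have := hΦ hab.symm hbc hac hjk hij.symm hik.symm hd hφ hq h1 hr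
      rw [h1, hq, hr, hφ.dist_eq_dist_iff] at hd
      exact hex.base_on_axis hφ.hw hq0 hqβ hr0 hrβ hd this
    · have := hΦ hac.symm hbc.symm hab hjk hij.symm hik.symm hd hφ hr h1 hq
      rw [h1, hq, hr, hφ.dist_eq_dist_iff] at hd
      exact hex.base_on_axis hφ.hw hr0 hrβ hq0 hqβ hd this
  · exfalso
    obtain ⟨β, u, w, φ, hφ⟩ := exists_isFrame (D.cross_points_ne_zero_of_ne hij hik hjk)
    obtain ⟨r, hr0, hrβ, hr⟩ := hφ.exists_eq_axis hij hik hjk h3 h4 h2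
    obtain ⟨t, ht0, ht1, ht⟩ := hφ.exists_eq_side hij hik hjk h5 h6 h7
    rw [← hφ.map_A] at h1
    rcases hiso.cases hab hac hbc with hd | hd | hd
    · have := hΦ hab hac hbc hij hik hjk hd hφ h1 hr ht
      rw [h1, hr, ht, hφ.dist_eq_dist_iff] at hd
      exact hex.origin_apex hφ.hb hφ.hw ht0 ht1 hr0 hrβ hd this
    · have := hΦ hab.symm hbc hac hij hik hjk hd hφ hr h1 ht
      rw [h1, hr, ht, hφ.dist_eq_dist_iff] at hd
      exact hex.axis_apex hφ.hb hφ.hw ht0 ht1 hr0 hrβ hd this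
    · have := hΦ hac.symm hbc.symm hab hij hik hjk hd hφ ht h1 hr
      rw [h1, hr, ht, hφ.dist_eq_dist_iff] at hd
      exact hex.side_apex hφ.hb hφ.hw ht0 ht1 hr0 hrβ hd this

/-! ### Turning maximality into coordinate inequalities -/

lemma isEmbeddedIsosceles_ofPoints {D : PlaneTriangle} {P Q R : Plane} (hP : P ∈ D.region)
    (hQ : Q ∈ D.region) (hR : R ∈ D.region) (hd : dist P Q = dist P R) (h : cross P Q R ≠ 0) :
    D.IsEmbeddedIsosceles (ofPoints P Q R h) := by
  refine ⟨⟨0, 1, 2, by decide, by decide, by decide, hd⟩, ?_⟩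
  rw [region_eq_convexHull, region_eq_convexHull D]
  apply convexHull_min _ (convex_convexHull _ _)
  rw [← region_eq_convexHull]
  rintro _ ⟨j, rfl⟩
  fin_cases j <;> assumption

lemma cross_sq_of_ne (T : PlaneTriangle) {a b c : Fin 3} (hab : a ≠ b) (hac : a ≠ c)
    (hbc : b ≠ c) : cross (T.points a) (T.points b) (T.points c) ^ 2 =
      cross (T.points 0) (T.points 1) (T.points 2) ^ 2 := by
  unfold cross
  fin_cases a <;> fin_cases b <;> fin_cases c <;> simp at hab hac hbc ⊢ <;> ring

lemma perimeter_eq_of_ne (T : PlaneTriangle) {a b c : Fin 3} (hab : a ≠ b) (hac : a ≠ c)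
    (hbc : b ≠ c) : T.perimeter = dist (T.points a) (T.points b) +
      dist (T.points b) (T.points c) + dist (T.points c) (T.points a) := by
  unfold perimeter
  have e1 := dist_comm (T.points 0) (T.points 1)
  have e2 := dist_comm (T.points 1) (T.points 2)
  have e3 := dist_comm (T.points 2) (T.points 0)
  fin_cases a <;> fin_cases b <;> fin_cases c <;> simp at hab hac hbc ⊢ <;> linarith

/-- Degenerate competitors have zero area and cause no trouble, so no nondegeneracy condition is
needed here, unlike for the perimeter. -/
lemma IsMaxAreaEmbeddedIsosceles.cross_sq_le {D T : PlaneTriangle}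
    (h : D.IsMaxAreaEmbeddedIsosceles T) {P Q R : Plane} (hP : P ∈ D.region)
    (hQ : Q ∈ D.region) (hR : R ∈ D.region) (hd : dist P Q = dist P R) :
    cross P Q R ^ 2 ≤ cross (T.points 0) (T.points 1) (T.points 2) ^ 2 := by
  by_cases h0 : cross P Q R = 0
  · rw [h0, zero_pow two_ne_zero]
    exact sq_nonneg _
  have := h.2 _ (isEmbeddedIsosceles_ofPoints hP hQ hR hd h0)
  obtain ⟨κ, hκ, H⟩ := exists_area_eq_mul_abs_cross
  rw [H, H, mul_le_mul_iff_right₀ hκ] at this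
  exact sq_le_sq.2 this

lemma IsMaxPerimeterEmbeddedIsosceles.dist_add_le {D T : PlaneTriangle}
    (h : D.IsMaxPerimeterEmbeddedIsosceles T) {P Q R : Plane} (hP : P ∈ D.region)
    (hQ : Q ∈ D.region) (hR : R ∈ D.region) (hd : dist P Q = dist P R) (h0 : cross P Q R ≠ 0) :
    dist P Q + dist Q R + dist R P ≤ T.perimeter := by
  have e : (ofPoints P Q R h0).perimeter = dist P Q + dist Q R + dist R P := by
    unfold perimeter
    rfl
  exact e ▸ h.2 _ (isEmbeddedIsosceles_ofPoints hP hQ hR hd h0)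

section Similarity

variable (c s p q : ℝ) (P Q R : Plane)

/-- The direct similarity `z ↦ (p + q i) + (c + s i) z`. -/
noncomputable def similarity (c s p q : ℝ) (P : Plane) : Plane :=
  !₂[p + c * P 0 - s * P 1, q + s * P 0 + c * P 1]

lemma dist_similarity : dist (similarity c s p q P) (similarity c s p q Q) =
    √(c ^ 2 + s ^ 2) * dist P Q := by
  rw [Plane.dist_eq, Plane.dist_eq, ← Real.sqrt_mul (by positivity)]
  congr 1
  simp [similarity]
  ring

lemma cross_similarity :
    cross (similarity c s p q P) (similarity c s p q Q) (similarity c s p q R) =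
      (c ^ 2 + s ^ 2) * cross P Q R := by
  simp [cross, similarity]
  ring

end Similarity

/-- A similar copy of an isosceles triangle is isosceles, and its area is scaled by `c ^ 2 + s ^ 2`.
-/
lemma IsMaxAreaEmbeddedIsosceles.noLargerCopy {D T : PlaneTriangle}
    (h : D.IsMaxAreaEmbeddedIsosceles T) : D.NoLargerCopy T := by
  intro c s p q hj
  change ∀ j, similarity c s p q (T.points j) ∈ D.region at hj
  obtain ⟨i, j, k, hij, hik, hjk, hd⟩ := h.1.1
  have := h.cross_sq_le (hj i) (hj j) (hj k) (by rw [dist_similarity, dist_similarity, hd])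
  rw [cross_similarity, mul_pow, T.cross_sq_of_ne hij hik hjk] at this
  have h0 := T.cross_points_ne_zero
  have h1 : (c ^ 2 + s ^ 2) ^ 2 ≤ 1 := le_of_mul_le_mul_right (by linarith) (pow_pos
    (abs_pos.2 h0) 2 |>.trans_eq (sq_abs _))
  nlinarith [sq_nonneg c, sq_nonneg s]

lemma IsMaxPerimeterEmbeddedIsosceles.noLargerCopy {D T : PlaneTriangle}
    (h : D.IsMaxPerimeterEmbeddedIsosceles T) : D.NoLargerCopy T := by
  intro c s p q hj
  by_contra! hlt
  change ∀ j, similarity c s p q (T.points j) ∈ D.region at hj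
  obtain ⟨i, j, k, hij, hik, hjk, hd⟩ := h.1.1
  have h1 : 1 < √(c ^ 2 + s ^ 2) := Real.lt_sqrt_of_sq_lt (by linarith)
  have := h.dist_add_le (hj i) (hj j) (hj k) (by rw [dist_similarity, dist_similarity, hd])
    (by
      rw [cross_similarity]
      exact mul_ne_zero (by positivity) (T.cross_points_ne_zero_of_ne hij hik hjk))
  rw [dist_similarity, dist_similarity, dist_similarity, T.perimeter_eq_of_ne hij hik hjk] at this
  have hpos : 0 < dist (T.points i) (T.points j) := dist_pos.2 (T.independent.injective.ne hij)
  have h2 : 0 ≤ dist (T.points j) (T.points k) := dist_nonneg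
  have h3 : 0 ≤ dist (T.points k) (T.points i) := dist_nonneg
  nlinarith

lemma IsMaxAreaEmbeddedIsosceles.shareSideAndAngle {D T : PlaneTriangle}
    (h : D.IsMaxAreaEmbeddedIsosceles T) : T.ShareSideAndAngle D := by
  refine shareSideAndAngle_of_excludesUnshared h.1.2 h.1.1 h.noLargerCopy
    excludesUnshared_isAreaMax ?_
  intro a b c i j k hab hac hbc hij hik hjk hd β u w φ hφ x₀ y₀ x₁ y₁ x₂ y₂ h0 h1 h2
    X₀ Y₀ X₁ Y₁ X₂ Y₂ t0 t1 t2 hiso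
  have := h.cross_sq_le ((hφ.mem_region_iff hij hik hjk _ _).2 t0)
    ((hφ.mem_region_iff hij hik hjk _ _).2 t1) ((hφ.mem_region_iff hij hik hjk _ _).2 t2)
    (hφ.dist_eq_dist_iff.2 hiso)
  obtain ⟨σ, hσ, H⟩ := hφ.cross_eq
  rwa [← T.cross_sq_of_ne hab hac hbc, h0, h1, h2, H, H, mul_pow, mul_pow, hσ, one_mul,
    one_mul] at this

lemma IsMaxPerimeterEmbeddedIsosceles.shareSideAndAngle {D T : PlaneTriangle}
    (h : D.IsMaxPerimeterEmbeddedIsosceles T) : T.ShareSideAndAngle D := by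
  refine shareSideAndAngle_of_excludesUnshared h.1.2 h.1.1 h.noLargerCopy
    excludesUnshared_isPerimeterMax ?_
  intro a b c i j k hab hac hbc hij hik hjk hd β u w φ hφ x₀ y₀ x₁ y₁ x₂ y₂ h0 h1 h2
    X₀ Y₀ X₁ Y₁ X₂ Y₂ t0 t1 t2 hiso hdet
  have hD := hφ.dist_eq_dist_iff.2 hiso
  have := h.dist_add_le ((hφ.mem_region_iff hij hik hjk _ _).2 t0)
    ((hφ.mem_region_iff hij hik hjk _ _).2 t1) ((hφ.mem_region_iff hij hik hjk _ _).2 t2) hD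
    (by
      obtain ⟨σ, hσ, H⟩ := hφ.cross_eq
      rw [H]
      exact mul_ne_zero (by rintro rfl; norm_num at hσ) hdet)
  rw [T.perimeter_eq_of_ne hab hac hbc, dist_comm (T.points c), ← hd, dist_comm (φ X₂ Y₂), ← hD,
    h0, h1, h2, hφ.dist_eq, hφ.dist_eq, hφ.dist_eq, hφ.dist_eq] at this
  linarith

end PlaneTriangle

theorem theorem1 (D : PlaneTriangle) :
    (∀ T : PlaneTriangle, D.IsMaxAreaEmbeddedIsosceles T → T.ShareSideAndAngle D) ∧
    (∀ T : PlaneTriangle, D.IsMaxPerimeterEmbeddedIsosceles T → T.ShareSideAndAngle D) :=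
  ⟨fun _ h => h.shareSideAndAngle, fun _ h => h.shareSideAndAngle⟩
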